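/- Write $\mathbb{R}_+=[0,\infty)$. Let $\psi:(-\infty,0]\to(-\infty,0]$ be continuous, smooth on $(-\infty,0)$ with $\psi^{(n)}\ge 0$ there for all $n\ge 1$, and $\psi(0)=0$. Suppose that $$\psi(s)=\int_{\mathbb{R}_+}(e^{su}-1)u^{-1}\,d\rho(u)\qquad(s\le 0),$$ where $\rho$ is a positive measure on $\mathbb{R}_+$ with $\rho([0,1])<\infty$ and $\int_{[1,\infty)}u^{-1}d\rho(u)<\infty$, and the integrand is read as $s$ at $u=0$. Let $a$ be a bounded complex measure on $\mathbb{R}_+$ and $g(s)=La(s)=\int_{\mathbb{R}_+}e^{su}\,da(u)$ $(s\le 0)$ its Laplace transform. Let $S$ be the set of all $\phi(t)=\sum_{j=1}^n c_je^{s_jt}$ with $c_j\in\mathbb{C}$, $s_j<0$ and $\sup_{t\ge 0}|\phi(t)|=1$, and put $$K(a,\rho)=\sup_{\phi\in S}\left|\int_{\mathbb{R}_+}\left(\int_{\mathbb{R}_+}\phi\,db^u\right)u^{-1}\,d\rho(u)\right|\in[0,\infty],$$ where $b^u$ is the translate of $a$ by $u$ minus $a$, so that $\int\phi\,db^u=\int(\phi(r+u)-\phi(r))\,da(r)$,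 and the integrand is read by continuity as $\int\phi'\,da$ at $u=0$. For a bounded $C_0$-semigroup $T$ on a complex Banach space $X$ with generator $A$, and a bounded complex measure $b$ on $\mathbb{R}_+$, let $(Lb)(A)$ be the bounded operator $x\mapsto\int_{\mathbb{R}_+}T(u)x\,db(u)$; let $\psi(A)$ be the closure of the operator $x\mapsto\int_{\mathbb{R}_+}(T(u)-I)x\,u^{-1}\,d\rho(u)$ with domain $D(A)$ (integrand $Ax$ at $u=0$). **Theorem 1.** If $K(a,\rho)<\infty$, then 1. the function $h=\psi g$ is of the form $h=Lb$ on $(-\infty,0]$ with a bounded complex measure $b$ on $\mathbb{R}_+$ whose total variation norm is $\|b\|=K(a,\rho)$; 2. $g(A)X\subset D(\psi(A))$, $h(A)=\psi(A)g(A)$ and $\|h(A)\|\le M\,K(a,\rho)$ for every operator $A$ in a complex Banach space $X$ that generates a $C_0$-semigroup $T$ with $\|T(t)\|\le M$ for all $t\ge 0$. -/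

import Mathlib

open MeasureTheory Filter Topology Set
open scoped NNReal ENNReal

namespace Subordination

/-! ### Bounded complex measures on `ℝ₊ = [0, ∞)` -/

/-- A complex measure has finite total variation, so `ComplexMeasure ℝ≥0` is the space of bounded
complex measures on `ℝ₊`; the norm of `a` is `a.variation univ`. -/
instance isFiniteMeasure_variation (a : ComplexMeasure ℝ≥0) : IsFiniteMeasure a.variation := by
  have hle : a.variation ≤
      (ComplexMeasure.re a).totalVariation + (ComplexMeasure.im a).totalVariation := by
    refine VectorMeasure.variation_le_of_forall_enorm_le fun E _ => ?_
    have h1 : a E = ((ComplexMeasure.re a E : ℝ) : ℂ) + ((ComplexMeasure.im a E : ℝ) : ℂ) *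
        Complex.I := by
      exact (Complex.re_add_im (a E)).symm
    calc ‖a E‖ₑ ≤ ‖((ComplexMeasure.re a E : ℝ) : ℂ)‖ₑ
          + ‖((ComplexMeasure.im a E : ℝ) : ℂ) * Complex.I‖ₑ := by
            conv_lhs => rw [h1]
            exact enorm_add_le _ _
      _ = ‖ComplexMeasure.re a E‖ₑ + ‖ComplexMeasure.im a E‖ₑ := by
            simp [← ofReal_norm]
      _ ≤ _ := by
            rw [Measure.add_apply]
            exact add_le_add (SignedMeasure.enorm_le_totalVariation _ _)
              (SignedMeasure.enorm_le_totalVariation _ _)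
  exact isFiniteMeasure_of_le _ hle

/-- The integral `∫ f da` of a function with values in a complex Banach space against a complex
measure on `ℝ₊`. -/
noncomputable def cintegral {E : Type*} [NormedAddCommGroup E] [NormedSpace ℂ E]
    (a : ComplexMeasure ℝ≥0) (f : ℝ≥0 → E) : E :=
  ∫ᵛ u, f u ∂[(ContinuousLinearMap.lsmul ℝ ℂ (E := E)).flip; a]

/-- The Laplace transform `La(s) = ∫ e^{su} da(u)`, used for `s ≤ 0`. -/
noncomputable def laplace (a : ComplexMeasure ℝ≥0) (s : ℝ) : ℂ :=
  cintegral a fun u => Complex.exp ((s : ℂ) * ((u : ℝ) : ℂ))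

/-! ### Negative Bernstein functions -/

/-- The class `𝓣` of negative Bernstein functions: functions `(-∞, 0] → (-∞, 0]`, continuous on
`(-∞, 0]`, smooth on `(-∞, 0)`, all of whose derivatives of order at least one are nonnegative.
Only the values of `ψ` on `(-∞, 0]` matter. -/
structure IsNegBernstein (ψ : ℝ → ℝ) : Prop where
  nonpos : ∀ s ≤ 0, ψ s ≤ 0
  continuousOn : ContinuousOn ψ (Iic 0)
  contDiffOn : ContDiffOn ℝ (⊤ : ℕ∞) ψ (Iio 0)
  iteratedDeriv_nonneg : ∀ n : ℕ, 1 ≤ n → ∀ s < 0, 0 ≤ iteratedDeriv n ψ s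

/-- The class `𝓣₀` of negative Bernstein functions vanishing at `0`. -/
structure IsNegBernsteinZero (ψ : ℝ → ℝ) : Prop extends IsNegBernstein ψ where
  map_zero : ψ 0 = 0

/-- The integrand `(e^{su} - 1) u⁻¹`, equal to `s` at `u = 0`. -/
noncomputable def levyKernel (s : ℝ) (u : ℝ≥0) : ℝ :=
  if u = 0 then s else (Real.exp (s * u) - 1) * (u : ℝ)⁻¹

/-- The function `ψ` has the integral representation
`ψ(s) = ψ(0) + ∫ (e^{su} - 1) u⁻¹ dρ(u)`, `s ≤ 0`, where the positive measure `ρ` on `ℝ₊` satisfies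
`∫_{[0,1]} dρ < ∞` and `∫_{[1,∞)} u⁻¹ dρ(u) < ∞`. -/
structure HasLevyRepr (ψ : ℝ → ℝ) (ρ : Measure ℝ≥0) : Prop where
  measure_Icc_lt_top : ρ (Icc 0 1) < ∞
  lintegral_Ici_lt_top : ∫⁻ u in Ici 1, (u : ℝ≥0∞)⁻¹ ∂ρ < ∞
  eq_integral : ∀ s ≤ 0, ψ s = ψ 0 + ∫ u, levyKernel s u ∂ρ

/-! ### The quantity `K(a, ρ)` -/

/-- The space `E(ℝ₊)` of exponential polynomials `t ↦ ∑ cⱼ e^{sⱼ t}` with `cⱼ ∈ ℂ`, `sⱼ < 0`. They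
are written as functions on `ℝ` so as to differentiate them at `0`; only their restriction to `ℝ₊`
is used. -/
noncomputable def expPoly : Submodule ℂ (ℝ → ℂ) :=
  Submodule.span ℂ {φ | ∃ s : ℝ, s < 0 ∧ φ = fun t : ℝ => Complex.exp ((s : ℂ) * (t : ℂ))}

/-- The unit sphere of `E(ℝ₊)` for the sup-norm on `ℝ₊`. -/
def expPolySphere : Set (ℝ → ℂ) :=
  {φ | φ ∈ expPoly ∧ ⨆ t : ℝ≥0, ‖φ t‖ = 1}

/-- The complex measure `b^u` on `ℝ₊` with distribution function `r ↦ a(r - u) - a(r)`, that is,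
the translate of `a` by `u` minus `a`. -/
noncomputable def translationDiff (a : ComplexMeasure ℝ≥0) (u : ℝ≥0) : ComplexMeasure ℝ≥0 :=
  a.map (fun r => r + u) - a

/-- The function `u ↦ u⁻¹ ∫ φ(r) d_r(a(r - u) - a(r))`; at `u = 0` it is
defined by continuity, its value being `∫ φ' da`. -/
noncomputable def translationQuotient (a : ComplexMeasure ℝ≥0) (φ : ℝ → ℂ) (u : ℝ≥0) : ℂ :=
  if u = 0 then cintegral a fun r => deriv φ r
  else (cintegral (translationDiff a u) fun r => φ r) * ((u : ℝ) : ℂ)⁻¹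

/-- `K(a, ρ) = sup_{φ ∈ S} |∫ ∫ φ(r) d_r(a(r - u) - a(r)) u⁻¹ dρ(u)|`, with values in `[0, ∞]`. -/
noncomputable def K (a : ComplexMeasure ℝ≥0) (ρ : Measure ℝ≥0) : ℝ≥0∞ :=
  ⨆ φ ∈ expPolySphere, ‖∫ u, translationQuotient a φ u ∂ρ‖ₑ

/-! ### Bounded `C₀`-semigroups and their generators -/

/-- A bounded strongly continuous one-parameter semigroup of operators on `X`. -/
structure BoundedC0Semigroup (X : Type*) [NormedAddCommGroup X] [NormedSpace ℂ X] where
  toFun : ℝ≥0 → X →L[ℂ] X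
  map_zero : toFun 0 = ContinuousLinearMap.id ℂ X
  map_add : ∀ s t, toFun (s + t) = (toFun s).comp (toFun t)
  continuous_orbit : ∀ x, Continuous fun t => toFun t x
  bounded : ∃ M : ℝ, ∀ t, ‖toFun t‖ ≤ M

namespace BoundedC0Semigroup

/-- The generator of a semigroup: `A x = lim_{t ↓ 0} t⁻¹ (T(t) x - x)`, on the subspace of those `x`
for which the limit exists. -/
noncomputable def generator {X : Type*} [NormedAddCommGroup X] [NormedSpace ℂ X]
    (T : BoundedC0Semigroup X) : X →ₗ.[ℂ] X where
  domain :=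
    { carrier := {x | ∃ y, Tendsto (fun t : ℝ≥0 => (t : ℝ)⁻¹ • (T.toFun t x - x)) (𝓝[>] 0) (𝓝 y)}
      zero_mem' := ⟨0, by simp⟩
      add_mem' := by
        rintro x₁ x₂ ⟨y₁, h₁⟩ ⟨y₂, h₂⟩
        refine ⟨y₁ + y₂, (h₁.add h₂).congr fun t => ?_⟩
        rw [← smul_add, _root_.map_add]
        congr 1
        abel
      smul_mem' := by
        rintro c x ⟨y, h⟩
        refine ⟨c • y, (h.const_smul c).congr fun t => ?_⟩
        rw [smul_comm, map_smul, smul_sub] }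
  toFun :=
    { toFun := fun x => x.2.choose
      map_add' := by
        intro x₁ x₂
        refine tendsto_nhds_unique (x₁ + x₂).2.choose_spec
          ((x₁.2.choose_spec.add x₂.2.choose_spec).congr fun t => ?_)
        rw [← smul_add, Submodule.coe_add, _root_.map_add]
        congr 1
        abel
      map_smul' := by
        intro c x
        refine tendsto_nhds_unique (c • x).2.choose_spec
          ((x.2.choose_spec.const_smul c).congr fun t => ?_)
        rw [smul_comm, Submodule.coe_smul, map_smul, smul_sub] }

theorem generator_tendsto {X : Type*} [NormedAddCommGroup X] [NormedSpace ℂ X]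
    (T : BoundedC0Semigroup X) (x : T.generator.domain) :
    Tendsto (fun t : ℝ≥0 => (t : ℝ)⁻¹ • (T.toFun t x - x)) (𝓝[>] 0) (𝓝 (T.generator x)) :=
  x.2.choose_spec

/-! ### The Hille–Phillips calculus -/

theorem integrable_orbit {X : Type*} [NormedAddCommGroup X] [NormedSpace ℂ X]
    (T : BoundedC0Semigroup X) (a : ComplexMeasure ℝ≥0) (x : X) :
    a.Integrable fun u => T.toFun u x := by
  obtain ⟨M, hM⟩ := T.bounded
  refine Integrable.of_bound (T.continuous_orbit x).aestronglyMeasurable (M * ‖x‖)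
    (Eventually.of_forall fun u => ?_)
  exact (T.toFun u).le_of_opNorm_le (hM u) x

/-- The Hille–Phillips calculus: for `g = La` the bounded operator `g(A)x = ∫ T(u)x da(u)`. -/
noncomputable def hillePhillips {X : Type*} [NormedAddCommGroup X] [NormedSpace ℂ X]
    (T : BoundedC0Semigroup X) (a : ComplexMeasure ℝ≥0) : X →L[ℂ] X :=
  LinearMap.mkContinuousOfExistsBound
    { toFun := fun x => cintegral a fun u => T.toFun u x
      map_add' := by
        intro x y
        simp only [_root_.map_add]
        exact VectorMeasure.integral_fun_add (T.integrable_orbit a x) (T.integrable_orbit a y)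
      map_smul' := by
        intro c x
        simp only [map_smul, RingHom.id_apply]
        refine setToFun_smul _ (fun c s x => ?_) c _
        exact smul_comm (a s) c x }
    (by
      obtain ⟨M, hM⟩ := T.bounded
      refine ⟨‖(ContinuousLinearMap.lsmul ℝ ℂ (E := X)).flip‖ * (M * a.variation.real univ),
        fun x => ?_⟩
      refine VectorMeasure.norm_integral_le_integral_norm.trans ?_
      rw [mul_assoc]
      refine mul_le_mul_of_nonneg_left ?_ (by positivity)
      calc ∫ u, ‖T.toFun u x‖ ∂a.variation ≤ ∫ _, M * ‖x‖ ∂a.variation := by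
            refine integral_mono (T.integrable_orbit a x).norm (integrable_const _) fun u => ?_
            exact (T.toFun u).le_of_opNorm_le (hM u) x
        _ = M * a.variation.real univ * ‖x‖ := by
            rw [integral_const, smul_eq_mul]
            ring)

/-! ### The Bochner–Phillips calculus -/

/-- The integrand `(T(u) - I)x u⁻¹` for `x ∈ D(A)`, equal to `Ax` at `u = 0`. -/
noncomputable def orbitQuotient {X : Type*} [NormedAddCommGroup X] [NormedSpace ℂ X]
    (T : BoundedC0Semigroup X) (x : T.generator.domain) (u : ℝ≥0) : X :=
  if u = 0 then T.generator x else (u : ℝ)⁻¹ • (T.toFun u x - x)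

theorem integrable_orbitQuotient {X : Type*} [NormedAddCommGroup X] [NormedSpace ℂ X]
    (T : BoundedC0Semigroup X) {ψ : ℝ → ℝ} {ρ : Measure ℝ≥0} (hρ : HasLevyRepr ψ ρ)
    (x : T.generator.domain) : Integrable (T.orbitQuotient x) ρ := by
  obtain ⟨M, hM⟩ := T.bounded
  have hcont : Continuous (T.orbitQuotient x) := by
    rw [continuous_iff_continuousAt]
    intro u
    by_cases hu : u = 0
    · subst hu
      rw [← continuousWithinAt_compl_self]
      have hset : ({0}ᶜ : Set ℝ≥0) = Ioi 0 := by
        ext v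
        simp [pos_iff_ne_zero]
      rw [ContinuousWithinAt, hset]
      have h0 : T.orbitQuotient x 0 = T.generator x := by simp [orbitQuotient]
      rw [h0]
      refine (T.generator_tendsto x).congr' ?_
      filter_upwards [self_mem_nhdsWithin] with v hv
      have hv' : v ≠ 0 := ne_of_gt hv
      simp [orbitQuotient, hv']
    · have hc : ContinuousAt (fun v : ℝ≥0 => (v : ℝ)⁻¹ • (T.toFun v x - x)) u := by
        have hinv : ContinuousAt (fun v : ℝ≥0 => (v : ℝ)⁻¹) u :=
          ContinuousAt.inv₀ NNReal.continuous_coe.continuousAt (by exact_mod_cast hu)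
        exact hinv.smul ((T.continuous_orbit x).continuousAt.sub continuousAt_const)
      refine hc.congr ?_
      filter_upwards [isOpen_ne.mem_nhds hu] with v hv
      simp only [orbitQuotient]
      rw [if_neg hv]
  have hmeas : AEStronglyMeasurable (T.orbitQuotient x) ρ := hcont.aestronglyMeasurable
  have hIcc : IntegrableOn (T.orbitQuotient x) (Icc 0 1) ρ := by
    obtain ⟨C, hC⟩ := isCompact_Icc.exists_bound_of_continuousOn
      (hcont.continuousOn (s := Icc (0 : ℝ≥0) 1))
    exact IntegrableOn.of_bound hρ.measure_Icc_lt_top hmeas.restrict C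
      ((ae_restrict_iff' measurableSet_Icc).2 (Eventually.of_forall hC))
  have hIci : IntegrableOn (T.orbitQuotient x) (Ici 1) ρ := by
    have hbase : IntegrableOn (fun u : ℝ≥0 => ((u⁻¹ : ℝ≥0) : ℝ)) (Ici 1) ρ := by
      refine ⟨(by fun_prop : Measurable fun u : ℝ≥0 => ((u⁻¹ : ℝ≥0) : ℝ)).aestronglyMeasurable, ?_⟩
      rw [hasFiniteIntegral_iff_enorm]
      refine lt_of_le_of_lt (setLIntegral_mono' measurableSet_Ici fun u hu => ?_)
        hρ.lintegral_Ici_lt_top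
      have hu0 : u ≠ 0 := ne_of_gt (lt_of_lt_of_le zero_lt_one hu)
      rw [← ENNReal.coe_inv hu0]
      simp [← ofReal_norm]
    refine Integrable.mono' (hbase.const_mul ((M + 1) * ‖(x : X)‖)) hmeas.restrict
      ((ae_restrict_iff' measurableSet_Ici).2 (Eventually.of_forall fun u hu => ?_))
    have hu0 : u ≠ 0 := ne_of_gt (lt_of_lt_of_le zero_lt_one hu)
    have h1 : ‖T.toFun u x - x‖ ≤ (M + 1) * ‖(x : X)‖ := by
      refine (norm_sub_le _ _).trans ?_
      have := (T.toFun u).le_of_opNorm_le (hM u) x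
      linarith
    simp only [orbitQuotient]
    rw [if_neg hu0, norm_smul, mul_comm, NNReal.coe_inv, Real.norm_of_nonneg (by positivity)]
    exact mul_le_mul_of_nonneg_right h1 (by positivity)
  have huniv : (univ : Set ℝ≥0) = Icc 0 1 ∪ Ici 1 := by
    ext u
    simp
  rw [← integrableOn_univ, huniv]
  exact hIcc.union hIci

/-- The operator `x ↦ ψ(0)x + ∫ (T(u) - I)x u⁻¹ dρ(u)` with domain `D(A)`. -/
noncomputable def bochnerPhillipsCore {X : Type*} [NormedAddCommGroup X] [NormedSpace ℂ X]
    (T : BoundedC0Semigroup X) {ψ : ℝ → ℝ} {ρ : Measure ℝ≥0} (hρ : HasLevyRepr ψ ρ) :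
    X →ₗ.[ℂ] X where
  domain := T.generator.domain
  toFun :=
    { toFun := fun x => (ψ 0 : ℂ) • (x : X) + ∫ u, T.orbitQuotient x u ∂ρ
      map_add' := by
        intro x y
        have h : T.orbitQuotient (x + y) = fun u => T.orbitQuotient x u + T.orbitQuotient y u := by
          funext u
          simp only [orbitQuotient]
          split_ifs with hu
          · exact LinearPMap.map_add _ _ _
          · rw [← smul_add, Submodule.coe_add, _root_.map_add]
            congr 1
            abel
        rw [h, integral_add (T.integrable_orbitQuotient hρ x) (T.integrable_orbitQuotient hρ y),
          Submodule.coe_add, smul_add]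
        abel
      map_smul' := by
        intro c x
        have h : T.orbitQuotient (c • x) = fun u => c • T.orbitQuotient x u := by
          funext u
          simp only [orbitQuotient]
          split_ifs with hu
          · exact LinearPMap.map_smul _ _ _
          · rw [smul_comm c, Submodule.coe_smul, map_smul, smul_sub c]
        rw [h, integral_smul, Submodule.coe_smul, RingHom.id_apply, smul_add, smul_comm] }

/-- The Bochner–Phillips calculus: `ψ(A)` is the closure of the operator
`x ↦ ψ(0)x + ∫ (T(u) - I)x u⁻¹ dρ(u)` on `D(A)`, where `A` is the generator of `T`. -/
noncomputable def bochnerPhillips {X : Type*} [NormedAddCommGroup X] [NormedSpace ℂ X]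
    (T : BoundedC0Semigroup X) {ψ : ℝ → ℝ} {ρ : Measure ℝ≥0} (hρ : HasLevyRepr ψ ρ) :
    X →ₗ.[ℂ] X :=
  (T.bochnerPhillipsCore hρ).closure

end BoundedC0Semigroup

end Subordination

/-!
Why the theorem is true. On an exponential sum `φ = ∑ cⱼ e^{sⱼ t}` the double integral in the
definition of `K(a, ρ)` is `∑ cⱼ ψ(sⱼ) g(sⱼ) = ∑ cⱼ h(sⱼ)`, because translating by `u` multiplies
`e^{st}` by `e^{su}`. So `K(a, ρ)` is the norm of the functional `e_s ↦ h(s)` on the exponential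
sums with the sup-norm. If it is finite, Hahn–Banach extends the functional to all bounded
continuous functions, and the Riesz theorem for complex functionals
(`exists_complexMeasure_eq_cintegral`) gives `b` with `|b|(ℝ₊) ≤ K(a, ρ)` and `Lb = h` on `(-∞, 0)`,
hence on `(-∞, 0]` by continuity; the converse inequality holds for every `b` with `Lb = h`. The
Riesz theorem is deduced from the Riesz–Markov–Kakutani theorem for positive functionals: the
absolute value of a functional `F` is represented by a positive measure `μ`, a second use of
Hahn–Banach extends `F` to `L¹(μ)`, and `b(E)` is the value of this extension at the indicator
function of `E`.

For the operators, let `R` be the resolvent of `A` at `l > 0`. The vector `T(r)Rx` is the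
exponential average `f(r) = ∫_{v > 0} e^{-lv} k(r + v) dv` of the bounded orbit `k(r) = T(r)x`, and
`ψ(A)g(A)Rx = h(A)Rx` is the identity `∫ (∫ (f(r + u) - f(r)) da(r)) u⁻¹ dρ(u) = ∫ f db`. For
`k(r) = e^{-jr} y` this is `ψ(-j)g(-j) = h(-j)`. Bernstein polynomials in `e^{-r}` show that every
bounded continuous vector-valued `k` is a bounded pointwise limit of sums of such functions
(`exists_seq_expSpan_tendsto`), and averaging makes the difference quotients `O(min(1, 1/u))`
uniformly along the sequence, so dominated convergence gives the identity for all `k`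
(`integral_averageQuotient`). Since `n R(n, A)x → x`, the pair `(g(A)x, h(A)x)` is in the closure of
the graph of `ψ(A)` on `D(A)`. That operator is closable, because its composition with `R` is
bounded. The same approximation shows that `h` determines `b`, which gives the norm estimate for
every representing measure.
-/

namespace Subordination

open scoped BoundedContinuousFunction CompactlySupported

/-! ### Integration against a complex measure -/

section ComplexIntegral

variable {E F : Type*} [NormedAddCommGroup E] [NormedSpace ℂ E] [NormedAddCommGroup F]
  [NormedSpace ℂ F] {a b : ComplexMeasure ℝ≥0} {f g : ℝ≥0 → E}

theorem norm_pairing_le_one :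
    ‖(ContinuousLinearMap.lsmul ℝ ℂ (E := E)).flip‖ ≤ 1 := by
  rw [ContinuousLinearMap.opNorm_flip]
  exact ContinuousLinearMap.opNorm_lsmul_le

theorem norm_cintegral_le_integral_norm (a : ComplexMeasure ℝ≥0) (f : ℝ≥0 → E) :
    ‖cintegral a f‖ ≤ ∫ u, ‖f u‖ ∂a.variation := by
  refine VectorMeasure.norm_integral_le_integral_norm.trans ?_
  exact mul_le_of_le_one_left (integral_nonneg fun _ => norm_nonneg _) norm_pairing_le_one

theorem norm_cintegral_le {C : ℝ} (hf : ∀ u, ‖f u‖ ≤ C) :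
    ‖cintegral a f‖ ≤ C * a.variation.real univ := by
  have hC : 0 ≤ C := (norm_nonneg _).trans (hf 0)
  refine (VectorMeasure.norm_integral_le_of_norm_le_const (Eventually.of_forall hf)).trans ?_
  refine mul_le_mul_of_nonneg_right ?_ measureReal_nonneg
  exact mul_le_of_le_one_right hC norm_pairing_le_one

omit [NormedSpace ℂ E] in
theorem integrable_variation (hf : Continuous f) {C : ℝ} (hC : ∀ u, ‖f u‖ ≤ C) :
    Integrable f a.variation :=
  Integrable.of_bound hf.aestronglyMeasurable C (Eventually.of_forall hC)

theorem cintegral_add (hf : Integrable f a.variation) (hg : Integrable g a.variation) :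
    (cintegral a fun u => f u + g u) = cintegral a f + cintegral a g :=
  VectorMeasure.integral_fun_add hf hg

theorem cintegral_sub (hf : Integrable f a.variation) (hg : Integrable g a.variation) :
    (cintegral a fun u => f u - g u) = cintegral a f - cintegral a g :=
  VectorMeasure.integral_fun_sub hf hg

theorem cintegral_zero : (cintegral a fun _ => (0 : E)) = 0 :=
  VectorMeasure.integral_zero

theorem cintegral_finset_sum {ι : Type*} (s : Finset ι) {f : ι → ℝ≥0 → E}
    (hf : ∀ i ∈ s, Integrable (f i) a.variation) :
    (cintegral a fun u => ∑ i ∈ s, f i u) = ∑ i ∈ s, cintegral a (f i) :=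
  VectorMeasure.integral_finsetSum s hf

theorem cintegral_const_smul (c : ℂ) (f : ℝ≥0 → E) :
    (cintegral a fun u => c • f u) = c • cintegral a f :=
  setToFun_smul _ (fun c s x => smul_comm (a s) c x) c f

theorem cintegral_indicator_const [CompleteSpace E] {s : Set ℝ≥0} (hs : MeasurableSet s) (c : E) :
    cintegral a (s.indicator fun _ => c) = a s • c :=
  setToFun_indicator_const _ hs (measure_ne_top _ _) c

theorem tendsto_cintegral {k : ℕ → ℝ≥0 → E} {C : ℝ} (hk : ∀ n, Continuous (k n))
    (hC : ∀ n u, ‖k n u‖ ≤ C) (hlim : ∀ u, Tendsto (fun n => k n u) atTop (𝓝 (f u))) :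
    Tendsto (fun n => cintegral a (k n)) atTop (𝓝 (cintegral a f)) :=
  VectorMeasure.tendsto_integral_of_dominated_convergence (fun _ => C)
    (fun n => (hk n).aestronglyMeasurable) (integrable_const C)
    (fun n => Eventually.of_forall (hC n)) (Eventually.of_forall hlim)

/-- A continuous operator on `L¹(μ)`, where `μ` dominates `|a|`, is integration against `a` as soon
as it is so on indicator functions. -/
theorem eq_cintegral_of_indicator [CompleteSpace E] {μ : Measure ℝ≥0} (hμ : a.variation ≤ μ)
    (L : (ℝ≥0 →₁[μ] E) →L[ℂ] E)
    (hL : ∀ (c : E) ⦃s : Set ℝ≥0⦄ (hs : MeasurableSet s) (hμs : μ s < ∞),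
      L (indicatorConstLp 1 hs hμs.ne c) = a s • c)
    (f : ℝ≥0 →₁[μ] E) : L f = cintegral a f := by
  have key : ∀ ⦃f : ℝ≥0 → E⦄, Integrable f μ → ∀ hf : Integrable f μ,
      L (hf.toL1 f) = cintegral a f := by
    refine fun f hf => Integrable.induction (μ := μ)
      (fun f => ∀ hf : Integrable f μ, L (hf.toL1 f) = cintegral a f) ?_ ?_ ?_ ?_ hf
    · intro c s hs hμs hf
      rw [cintegral_indicator_const hs, ← hL c hs hμs]
      rfl
    · intro f g _ hf hg hLf hLg hfg
      rw [Integrable.toL1_add f g hf hg, map_add, hLf hf, hLg hg]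
      exact (cintegral_add (hf.mono_measure hμ) (hg.mono_measure hμ)).symm
    · have hle : ∀ f : ℝ≥0 →₁[μ] E, Integrable f a.variation := fun f =>
        (L1.integrable_coeFn f).mono_measure hμ
      have hset : {f : ℝ≥0 →₁[μ] E | ∀ hf : Integrable f μ, L (hf.toL1 f) = cintegral a f}
          = {f | L f = cintegral a f} := by
        ext f
        simp only [Integrable.toL1_coeFn, mem_ofPred_eq]
        exact ⟨fun h => h (L1.integrable_coeFn f), fun h _ => h⟩
      rw [hset]
      refine isClosed_eq L.continuous (LipschitzWith.continuous (K := 1)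
        (LipschitzWith.of_dist_le_mul fun f g => ?_))
      rw [dist_eq_norm, ← cintegral_sub (hle f) (hle g), NNReal.coe_one, one_mul, dist_eq_norm,
        L1.norm_eq_integral_norm]
      refine (norm_cintegral_le_integral_norm _ _).trans ?_
      calc ∫ u, ‖f u - g u‖ ∂a.variation ≤ ∫ u, ‖f u - g u‖ ∂μ :=
            integral_mono_measure hμ (Eventually.of_forall fun _ => norm_nonneg _)
              ((L1.integrable_coeFn f).sub (L1.integrable_coeFn g)).norm
        _ = ∫ u, ‖(f - g) u‖ ∂μ := integral_congr_ae <| by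
            filter_upwards [Lp.coeFn_sub f g] with u hu
            rw [hu, Pi.sub_apply]
    · intro f g hfg hf hLf hg
      rw [← (Integrable.toL1_eq_toL1_iff f g hf hg).2 hfg, hLf hf]
      exact VectorMeasure.integral_congr_ae ((Measure.absolutelyContinuous_of_le hμ).ae_eq hfg)
  have := key (L1.integrable_coeFn f) (L1.integrable_coeFn f)
  rwa [Integrable.toL1_coeFn] at this

theorem cintegral_comp_comm [CompleteSpace E] [CompleteSpace F] (L : E →L[ℂ] F)
    (hf : Integrable f a.variation) :
    (cintegral a fun u => L (f u)) = L (cintegral a f) := by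
  refine Integrable.induction (μ := a.variation)
      (fun f => (cintegral a fun u => L (f u)) = L (cintegral a f)) ?_ ?_ ?_ ?_ hf
  · intro c s hs _
    have h : (fun u => L (s.indicator (fun _ => c) u)) = s.indicator fun _ => L c := by
      funext u
      by_cases hu : u ∈ s <;> simp [hu]
    rw [cintegral_indicator_const hs, h, cintegral_indicator_const hs, map_smul]
  · intro f g _ hf hg hLf hLg
    simp only [Pi.add_apply, map_add]
    rw [cintegral_add (L.integrable_comp hf) (L.integrable_comp hg), hLf, hLg,
      ← map_add]
    congr 1
    exact (cintegral_add hf hg).symm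
  · have hc1 : Continuous fun f : ℝ≥0 →₁[a.variation] E => cintegral a f :=
      VectorMeasure.continuous_integral
    have hc2 : Continuous fun f : ℝ≥0 →₁[a.variation] E => cintegral a fun u => L (f u) := by
      have h := VectorMeasure.continuous_integral (μ := a) (E := F)
        (B := (ContinuousLinearMap.lsmul ℝ ℂ (E := F)).flip)
      refine (h.comp (L.compLpL 1 a.variation).continuous).congr fun f => ?_
      exact VectorMeasure.integral_congr_ae (L.coeFn_compLpL f)
    exact isClosed_eq hc2 (L.continuous.comp hc1)
  · intro f g hfg _ hLf
    have h1 : cintegral a g = cintegral a f := VectorMeasure.integral_congr_ae hfg.symm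
    have h2 : (cintegral a fun u => L (g u)) = cintegral a fun u => L (f u) :=
      VectorMeasure.integral_congr_ae (hfg.symm.fun_comp L)
    rw [h1, h2, hLf]

theorem cintegral_smul_const [CompleteSpace E] {φ : ℝ≥0 → ℂ} (hφ : Integrable φ a.variation)
    (y : E) : (cintegral a fun u => φ u • y) = cintegral a φ • y :=
  cintegral_comp_comm (ContinuousLinearMap.toSpanSingleton ℂ y) hφ

theorem cintegral_map_add_right (u : ℝ≥0) (hf : Continuous f) {C : ℝ} (hC : ∀ r, ‖f r‖ ≤ C) :
    cintegral (a.map fun r => r + u) f = cintegral a fun r => f (r + u) :=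
  VectorMeasure.integral_map (by fun_prop) hf.aestronglyMeasurable
    (integrable_variation (by fun_prop) fun r => hC (r + u))

theorem cintegral_translationDiff (u : ℝ≥0) (hf : Continuous f) {C : ℝ} (hC : ∀ r, ‖f r‖ ≤ C) :
    cintegral (translationDiff a u) f = cintegral a fun r => f (r + u) - f r := by
  rw [cintegral_sub (integrable_variation (by fun_prop) fun r => hC (r + u))
    (integrable_variation hf hC), ← cintegral_map_add_right u hf hC]
  exact VectorMeasure.integral_sub_vectorMeasure (integrable_variation hf hC)
    (integrable_variation hf hC)

end ComplexIntegral

/-! ### Bounded pointwise approximation by exponential polynomials -/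

section Approximation

variable {E : Type*} [NormedAddCommGroup E] [NormedSpace ℂ E]

/-- The exponential `t ↦ e^{st}` on `ℝ₊`. -/
noncomputable def expFun (s : ℝ) (t : ℝ≥0) : ℂ :=
  Complex.exp ((s : ℂ) * ((t : ℝ) : ℂ))

theorem expFun_eq_ofReal (s : ℝ) (t : ℝ≥0) : expFun s t = (Real.exp (s * t) : ℝ) := by
  simp [expFun]

theorem continuous_expFun (s : ℝ) : Continuous (expFun s) := by
  unfold expFun
  fun_prop

theorem norm_expFun (s : ℝ) (t : ℝ≥0) : ‖expFun s t‖ = Real.exp (s * t) := by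
  rw [expFun_eq_ofReal, Complex.norm_real, Real.norm_of_nonneg (Real.exp_nonneg _)]

theorem norm_expFun_le_one {s : ℝ} (hs : s ≤ 0) (t : ℝ≥0) : ‖expFun s t‖ ≤ 1 := by
  rw [norm_expFun, Real.exp_le_one_iff]
  exact mul_nonpos_of_nonpos_of_nonneg hs t.2

theorem expFun_add (s : ℝ) (r u : ℝ≥0) : expFun s (r + u) = expFun s r * expFun s u := by
  rw [expFun, expFun, expFun, ← Complex.exp_add]
  congr 1
  push_cast
  ring

/-- The span of the functions `t ↦ e^{-jt} y` with `j ∈ ℕ` and `y ∈ E`. -/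
noncomputable def expSpan (E : Type*) [NormedAddCommGroup E] [NormedSpace ℂ E] :
    Submodule ℂ (ℝ≥0 → E) :=
  Submodule.span ℂ {k | ∃ (j : ℕ) (y : E), k = fun t => expFun (-j) t • y}

theorem expSpan_continuous {k : ℝ≥0 → E} (hk : k ∈ expSpan E) : Continuous k := by
  induction hk using Submodule.span_induction with
  | mem k hk =>
    obtain ⟨j, y, rfl⟩ := hk
    exact (continuous_expFun _).smul continuous_const
  | zero => exact continuous_const
  | add f g _ _ hf hg => exact hf.add hg
  | smul c f _ hf => exact hf.const_smul c

theorem eval_exp_smul_mem_expSpan (p : Polynomial ℝ) (y : E) :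
    (fun t : ℝ≥0 => p.eval (Real.exp (-t)) • y) ∈ expSpan E := by
  have h : (fun t : ℝ≥0 => p.eval (Real.exp (-t)) • y)
      = ∑ i ∈ Finset.range (p.natDegree + 1), fun t : ℝ≥0 =>
          expFun (-i) t • ((p.coeff i : ℂ) • y) := by
    funext t
    rw [Polynomial.eval_eq_sum_range, Finset.sum_smul, Finset.sum_apply]
    refine Finset.sum_congr rfl fun i _ => ?_
    rw [smul_smul, expFun_eq_ofReal, ← Complex.ofReal_mul, Complex.coe_smul, ← Real.exp_nat_mul,
      mul_comm]
    ring_nf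
  rw [h]
  exact Submodule.sum_mem _ fun i _ => Submodule.subset_span ⟨i, _, rfl⟩

/-- The change of variable `x = e^{-t}` turns the Bernstein polynomials of a continuous function on
`[0, 1]` into exponential polynomials on `ℝ₊`. -/
theorem bernsteinApproximation_exp_mem_expSpan (m : ℕ) (h : C(unitInterval, E)) :
    (fun t : ℝ≥0 => bernsteinApproximation m h
      ⟨Real.exp (-t), (Real.exp_pos _).le, Real.exp_le_one_iff.2 (neg_nonpos.2 t.2)⟩)
      ∈ expSpan E := by
  have heq : (fun t : ℝ≥0 => bernsteinApproximation m h
      ⟨Real.exp (-t), (Real.exp_pos _).le, Real.exp_le_one_iff.2 (neg_nonpos.2 t.2)⟩)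
      = ∑ i : Fin (m + 1), fun t : ℝ≥0 =>
          (bernsteinPolynomial ℝ m i).eval (Real.exp (-t)) • h (bernstein.z i) := by
    funext t
    rw [bernsteinApproximation.apply, Finset.sum_apply]
    rfl
  rw [heq]
  exact Submodule.sum_mem _ fun i _ => eval_exp_smul_mem_expSpan _ _

/-- A bounded continuous function on `ℝ₊` is the pointwise limit of a bounded sequence of
exponential polynomials. -/
theorem exists_seq_expSpan_tendsto {k : ℝ≥0 → E} (hk : Continuous k) {C : ℝ}
    (hC : ∀ t, ‖k t‖ ≤ C) :
    ∃ κ : ℕ → ℝ≥0 → E, (∀ n, κ n ∈ expSpan E) ∧ (∀ n t, ‖κ n t‖ ≤ C + 1) ∧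
      ∀ t, Tendsto (fun n => κ n t) atTop (𝓝 (k t)) := by
  -- In the variable `x = e^{-t}` the function may have no limit at `x = 0`; it is frozen on
  -- `[0, e^{-n}]`, that is, for `t ≥ n`.
  have hcont : ∀ n : ℕ, Continuous fun x : unitInterval =>
      k (Real.toNNReal (-Real.log (max (x : ℝ) (Real.exp (-n))))) := fun n => by
    refine hk.comp (continuous_real_toNNReal.comp (Continuous.neg (Continuous.log ?_ fun x => ?_)))
    · fun_prop
    · exact (lt_max_of_lt_right (Real.exp_pos _)).ne'
  let h : ℕ → C(unitInterval, E) := fun n => ⟨_, hcont n⟩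
  have hm : ∀ n : ℕ, ∃ m, ‖bernsteinApproximation m (h n) - h n‖ < 1 / ((n : ℝ) + 1) := fun n => by
    obtain ⟨m, hm⟩ := ((Metric.tendsto_nhds.1 (bernsteinApproximation_uniform (h n)))
      (1 / ((n : ℝ) + 1)) Nat.one_div_pos_of_nat).exists
    exact ⟨m, by rwa [← dist_eq_norm]⟩
  choose m hm using hm
  let x : ℝ≥0 → unitInterval := fun t =>
    ⟨Real.exp (-t), (Real.exp_pos _).le, Real.exp_le_one_iff.2 (neg_nonpos.2 t.2)⟩
  have happ : ∀ n t, ‖bernsteinApproximation (m n) (h n) (x t) - h n (x t)‖ ≤ 1 / ((n : ℝ) + 1) :=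
    fun n t => ((bernsteinApproximation (m n) (h n) - h n).norm_coe_le_norm (x t)).trans (hm n).le
  refine ⟨fun n t => bernsteinApproximation (m n) (h n) (x t),
    fun n => bernsteinApproximation_exp_mem_expSpan _ _, fun n t => ?_, fun t => ?_⟩
  · have h1 : 1 / ((n : ℝ) + 1) ≤ 1 := by
      rw [div_le_one (by positivity)]
      linarith [(Nat.cast_nonneg n : (0 : ℝ) ≤ n)]
    have h2 : ‖h n (x t)‖ ≤ C := hC _
    have h3 := norm_le_norm_add_norm_sub (h n (x t)) (bernsteinApproximation (m n) (h n) (x t))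
    rw [norm_sub_rev] at h3
    linarith [happ n t]
  · have h0 : Tendsto (fun n => bernsteinApproximation (m n) (h n) (x t) - h n (x t)) atTop (𝓝 0) :=
      squeeze_zero_norm (fun n => happ n t) tendsto_one_div_add_atTop_nhds_zero_nat
    have hev : (fun n => h n (x t)) =ᶠ[atTop] fun _ => k t := by
      obtain ⟨N, hN⟩ := exists_nat_ge (t : ℝ)
      filter_upwards [eventually_ge_atTop N] with n hn
      have htn : (t : ℝ) ≤ n := hN.trans (by exact_mod_cast hn)
      simp only [h, x, ContinuousMap.coe_mk]
      rw [max_eq_left (Real.exp_le_exp.2 (neg_le_neg htn)), Real.log_exp, neg_neg,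
        Real.toNNReal_coe]
    have := h0.add (tendsto_const_nhds.congr' hev.symm)
    simpa using this

end Approximation

/-! ### Uniqueness of the Laplace transform -/

section Uniqueness

variable {a b : ComplexMeasure ℝ≥0}

theorem laplace_eq_cintegral_expFun (a : ComplexMeasure ℝ≥0) (s : ℝ) :
    laplace a s = cintegral a (expFun s) := rfl

theorem integrable_expFun {s : ℝ} (hs : s ≤ 0) : Integrable (expFun s) a.variation :=
  integrable_variation (continuous_expFun s) (norm_expFun_le_one hs)

theorem cintegral_eq_of_laplace_eq (h : ∀ s ≤ 0, laplace a s = laplace b s) {k : ℝ≥0 → ℂ}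
    (hk : Continuous k) {C : ℝ} (hC : ∀ t, ‖k t‖ ≤ C) : cintegral a k = cintegral b k := by
  obtain ⟨κ, hκ, hκC, hlim⟩ := exists_seq_expSpan_tendsto hk hC
  have hcont := fun n => expSpan_continuous (hκ n)
  have heq : ∀ κ ∈ expSpan ℂ, Integrable κ a.variation ∧ Integrable κ b.variation ∧
      cintegral a κ = cintegral b κ := fun κ hκ => by
    induction hκ using Submodule.span_induction with
    | mem κ hκ =>
      obtain ⟨j, y, rfl⟩ := hκ
      have hj : -(j : ℝ) ≤ 0 := by simp
      refine ⟨(integrable_expFun hj).smul_const y, (integrable_expFun hj).smul_const y, ?_⟩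
      rw [cintegral_smul_const (integrable_expFun hj), cintegral_smul_const (integrable_expFun hj)]
      exact congrArg (· • y) (h _ hj)
    | zero => exact ⟨integrable_zero _ _ _, integrable_zero _ _ _,
        (cintegral_zero (a := a)).trans (cintegral_zero (a := b)).symm⟩
    | add f g _ _ hf hg =>
      refine ⟨hf.1.add hg.1, hf.2.1.add hg.2.1, ?_⟩
      have h1 := cintegral_add hf.1 hg.1
      have h2 := cintegral_add hf.2.1 hg.2.1
      rw [hf.2.2, hg.2.2, ← h2] at h1
      exact h1
    | smul c f _ hf =>
      refine ⟨hf.1.smul c, hf.2.1.smul c, ?_⟩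
      have h1 := cintegral_const_smul (a := a) c f
      have h2 := cintegral_const_smul (a := b) c f
      rw [hf.2.2, ← h2] at h1
      exact h1
  refine tendsto_nhds_unique (tendsto_cintegral hcont hκC hlim) ?_
  simp_rw [fun n => (heq _ (hκ n)).2.2]
  exact tendsto_cintegral hcont hκC hlim

theorem eq_of_forall_cintegral_eq
    (h : ∀ k : ℝ≥0 → ℂ, Continuous k → (∀ t, ‖k t‖ ≤ 1) → cintegral a k = cintegral b k) :
    a = b := by
  have hclosed : ∀ s : Set ℝ≥0, IsClosed s → a s = b s := fun s hs => by
    obtain ⟨δ, -, hδ, hlim⟩ := exists_seq_strictAnti_tendsto (0 : ℝ)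
    let k : ℕ → ℝ≥0 → ℂ := fun n t => ((thickenedIndicator (hδ n) s t : ℝ) : ℂ)
    have hk : ∀ n, Continuous (k n) := fun n => Complex.continuous_ofReal.comp
      (NNReal.continuous_coe.comp (thickenedIndicator (hδ n) s).continuous)
    have hk1 : ∀ n t, ‖k n t‖ ≤ 1 := fun n t => by
      simp only [k, Complex.norm_real, NNReal.norm_eq]
      exact_mod_cast thickenedIndicator_le_one (hδ n) s t
    have hkl : ∀ t, Tendsto (fun n => k n t) atTop (𝓝 (s.indicator (fun _ => (1 : ℂ)) t)) := by
      intro t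
      have h1 := tendsto_pi_nhds.1 (thickenedIndicator_tendsto_indicator_closure
        hδ hlim s) t
      rw [hs.closure_eq] at h1
      have h2 := (Complex.continuous_ofReal.comp NNReal.continuous_coe).continuousAt.tendsto.comp h1
      refine h2.congr' (Eventually.of_forall fun _ => rfl) |>.trans (le_of_eq ?_)
      congr 1
      by_cases ht : t ∈ s <;> simp [ht]
    have ha := tendsto_cintegral (a := a) hk hk1 hkl
    have hb := tendsto_cintegral (a := b) hk hk1 hkl
    simp_rw [fun n => h (k n) (hk n) (hk1 n)] at ha
    have := tendsto_nhds_unique ha hb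
    simpa [cintegral_indicator_const hs.measurableSet] using this
  refine VectorMeasure.ext fun s hs => ?_
  have hgen : (inferInstance : MeasurableSpace ℝ≥0)
      = MeasurableSpace.generateFrom {s | IsClosed s} := by
    rw [← borel_eq_generateFrom_isClosed]
    exact BorelSpace.measurable_eq
  induction s, hs using MeasurableSpace.induction_on_inter hgen isPiSystem_isClosed with
  | empty => simp
  | basic s hs => exact hclosed s hs
  | compl s hs ih =>
    have h1 := VectorMeasure.of_add_of_sdiff (v := a) hs MeasurableSet.univ (subset_univ s)
    have h2 := VectorMeasure.of_add_of_sdiff (v := b) hs MeasurableSet.univ (subset_univ s)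
    rw [hclosed univ isClosed_univ, ← h2, ih] at h1
    rw [compl_eq_univ_sdiff]
    exact add_left_cancel h1
  | iUnion f hd hf ih =>
    rw [VectorMeasure.of_disjoint_iUnion hf hd, VectorMeasure.of_disjoint_iUnion hf hd]
    exact tsum_congr ih

theorem eq_of_laplace_eq (h : ∀ s ≤ 0, laplace a s = laplace b s) : a = b :=
  eq_of_forall_cintegral_eq fun _ hk hk1 => cintegral_eq_of_laplace_eq h hk hk1

end Uniqueness

/-! ### Riesz representation of bounded functionals by complex measures -/

/-- The form of the Hahn–Banach theorem in which a functional `G` is dominated through a linear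
map `S` that need not be injective. -/
theorem exists_dual_comp_eq {W V : Type*} [AddCommGroup W] [Module ℂ W] [NormedAddCommGroup V]
    [NormedSpace ℂ V] (S : W →ₗ[ℂ] V) (G : W →ₗ[ℂ] ℂ) {C : ℝ} (hC : 0 ≤ C)
    (h : ∀ w, ‖G w‖ ≤ C * ‖S w‖) :
    ∃ F : V →L[ℂ] ℂ, ‖F‖ ≤ C ∧ ∀ w, F (S w) = G w := by
  obtain ⟨r, hr⟩ := S.rangeRestrict.exists_rightInverse_of_surjective S.range_rangeRestrict
  have hr' : ∀ y : LinearMap.range S, S (r y) = y := fun y =>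
    congrArg Subtype.val (LinearMap.congr_fun hr y)
  let f : LinearMap.range S →L[ℂ] ℂ := LinearMap.mkContinuous (G ∘ₗ r) C fun y => by
    refine (h (r y)).trans (le_of_eq ?_)
    rw [hr' y]
    rfl
  obtain ⟨F, hF, hFn⟩ := exists_extension_norm_eq (LinearMap.range S) f
  refine ⟨F, hFn.trans_le (LinearMap.mkContinuous_norm_le _ hC _), fun w => ?_⟩
  have h1 : F (S w) = G (r (S.rangeRestrict w)) := hF (S.rangeRestrict w)
  rw [h1, ← sub_eq_zero, ← map_sub, ← norm_le_zero_iff]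
  refine (h _).trans (le_of_eq ?_)
  rw [map_sub, hr']
  change C * ‖S w - S w‖ = 0
  rw [sub_self, norm_zero, mul_zero]

section DominatingFunctional

variable {X : Type*} [TopologicalSpace X] (F : (X →ᵇ ℂ) →L[ℂ] ℂ)

/-- The absolute value of a functional `F`, evaluated at `f ≥ 0`: the supremum of `|F g|` over the
functions `g` with `|g| ≤ f`. -/
noncomputable def absFunctional (f : C_c(X, ℝ≥0)) : ℝ≥0 :=
  ⨆ g : {g : X →ᵇ ℂ // ∀ x, ‖g x‖₊ ≤ f x}, ‖F g‖₊

theorem bddAbove_range_nnnorm (f : C_c(X, ℝ≥0)) :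
    BddAbove (range fun g : {g : X →ᵇ ℂ // ∀ x, ‖g x‖₊ ≤ f x} => ‖F g‖₊) := by
  obtain ⟨B, hB⟩ := f.continuous.bddAbove_range_of_hasCompactSupport f.hasCompactSupport
  refine ⟨‖F‖₊ * B, ?_⟩
  rintro _ ⟨g, rfl⟩
  refine (F.le_opNNNorm g).trans (mul_le_mul_right ?_ _)
  exact (BoundedContinuousFunction.norm_le B.2).2 fun x => (g.2 x).trans (hB (mem_range_self x))

instance (f : C_c(X, ℝ≥0)) : Nonempty {g : X →ᵇ ℂ // ∀ x, ‖g x‖₊ ≤ f x} := ⟨0, by simp⟩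

variable {F}

theorem nnnorm_le_absFunctional {f : C_c(X, ℝ≥0)} {g : X →ᵇ ℂ} (h : ∀ x, ‖g x‖₊ ≤ f x) :
    ‖F g‖₊ ≤ absFunctional F f :=
  le_ciSup (bddAbove_range_nnnorm F f) ⟨g, h⟩

theorem absFunctional_le {f : C_c(X, ℝ≥0)} {C : ℝ≥0}
    (h : ∀ g : X →ᵇ ℂ, (∀ x, ‖g x‖₊ ≤ f x) → ‖F g‖₊ ≤ C) : absFunctional F f ≤ C :=
  ciSup_le fun g => h g g.2

theorem mul_absFunctional_le (c : ℝ≥0) (f : C_c(X, ℝ≥0)) :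
    c * absFunctional F f ≤ absFunctional F (c • f) := by
  refine NNReal.mul_iSup_le fun g => ?_
  have h : c * ‖F g‖₊ = ‖F ((c : ℂ) • g.1)‖₊ := by
    rw [map_smul, nnnorm_smul]
    congr 1
    ext
    simp
  rw [h]
  refine nnnorm_le_absFunctional fun x => ?_
  rw [BoundedContinuousFunction.smul_apply, nnnorm_smul, CompactlySupportedContinuousMap.smul_apply,
    smul_eq_mul]
  refine mul_le_mul' (le_of_eq ?_) (g.2 x)
  ext
  simp

theorem absFunctional_smul (c : ℝ≥0) (f : C_c(X, ℝ≥0)) :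
    absFunctional F (c • f) = c * absFunctional F f := by
  refine le_antisymm ?_ (mul_absFunctional_le c f)
  rcases eq_or_ne c 0 with rfl | hc
  · refine absFunctional_le fun g hg => ?_
    have : g = 0 := by
      ext x
      simpa using hg x
    simp [this]
  · have h := mul_absFunctional_le (F := F) c⁻¹ (c • f)
    rw [smul_smul, inv_mul_cancel₀ hc, one_smul] at h
    calc absFunctional F (c • f) = c * (c⁻¹ * absFunctional F (c • f)) := by
          rw [mul_inv_cancel_left₀ hc]
      _ ≤ _ := mul_le_mul_right h c

theorem absFunctional_add_le (f₁ f₂ : C_c(X, ℝ≥0)) :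
    absFunctional F (f₁ + f₂) ≤ absFunctional F f₁ + absFunctional F f₂ := by
  refine absFunctional_le fun g hg => ?_
  -- `g` is split in the proportion `f₁ : f₂`; adding `ε` to the denominator keeps the two parts
  -- continuous at the zeros of `f₁ + f₂`, at the price of an error of norm at most `ε`.
  have key : ∀ ε : ℝ, 0 < ε →
      ‖F g‖ ≤ absFunctional F f₁ + absFunctional F f₂ + ‖F‖ * ε := fun ε hε => by
    have hg' : ∀ x, ‖g x‖ ≤ f₁ x + f₂ x := fun x => by exact_mod_cast hg x
    have hden : ∀ x, 0 < (f₁ x : ℝ) + f₂ x + ε := fun x => by positivity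
    have part : ∀ f : C_c(X, ℝ≥0), (∀ x, (f x : ℝ) ≤ f₁ x + f₂ x) → ∃ h : X →ᵇ ℂ,
        (∀ x, h x = (((f x : ℝ) / (f₁ x + f₂ x + ε) : ℝ) : ℂ) * g x) ∧ ∀ x, ‖h x‖₊ ≤ f x := by
      intro f hf
      have hcont : Continuous fun x => (((f x : ℝ) / (f₁ x + f₂ x + ε) : ℝ) : ℂ) * g x := by
        refine (Complex.continuous_ofReal.comp (Continuous.div ?_ ?_ fun x => (hden x).ne')).mul
          g.continuous
        · exact NNReal.continuous_coe.comp f.continuous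
        · exact ((NNReal.continuous_coe.comp f₁.continuous).add
            (NNReal.continuous_coe.comp f₂.continuous)).add continuous_const
      have hle : ∀ x, ‖(((f x : ℝ) / (f₁ x + f₂ x + ε) : ℝ) : ℂ) * g x‖ ≤ f x := fun x => by
        rw [norm_mul, Complex.norm_real,
          Real.norm_of_nonneg (div_nonneg (f x).coe_nonneg (hden x).le),
          div_mul_eq_mul_div, div_le_iff₀ (hden x)]
        exact mul_le_mul_of_nonneg_left (by linarith [hg' x]) (f x).coe_nonneg
      obtain ⟨B, hB⟩ := f.continuous.bddAbove_range_of_hasCompactSupport f.hasCompactSupport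
      exact ⟨BoundedContinuousFunction.ofNormedAddCommGroup _ hcont B fun x =>
        (hle x).trans (by exact_mod_cast hB (mem_range_self x)), fun x => rfl, hle⟩
    obtain ⟨h₁, hh₁, hle₁⟩ := part f₁ fun x => by simp
    obtain ⟨h₂, hh₂, hle₂⟩ := part f₂ fun x => by simp
    have hrest : ‖g - h₁ - h₂‖ ≤ ε := by
      refine (BoundedContinuousFunction.norm_le hε.le).2 fun x => ?_
      have hd : ((f₁ x : ℝ) : ℂ) + ((f₂ x : ℝ) : ℂ) + (ε : ℂ) ≠ 0 := by
        exact_mod_cast (hden x).ne'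
      have : (g - h₁ - h₂) x = ((ε / (f₁ x + f₂ x + ε) : ℝ) : ℂ) * g x := by
        rw [BoundedContinuousFunction.sub_apply, BoundedContinuousFunction.sub_apply, hh₁, hh₂]
        push_cast
        field_simp
        ring
      rw [this, norm_mul, Complex.norm_real, Real.norm_of_nonneg (div_nonneg hε.le (hden x).le),
        div_mul_eq_mul_div, div_le_iff₀ (hden x)]
      exact mul_le_mul_of_nonneg_left (by linarith [hg' x]) hε.le
    calc ‖F g‖ = ‖F h₁ + F h₂ + F (g - h₁ - h₂)‖ := by
          rw [← map_add, ← map_add]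
          congr 2
          abel
      _ ≤ ‖F h₁‖ + ‖F h₂‖ + ‖F (g - h₁ - h₂)‖ := norm_add₃_le
      _ ≤ _ := by
          gcongr
          · exact nnnorm_le_absFunctional hle₁
          · exact nnnorm_le_absFunctional hle₂
          · exact F.le_opNorm_of_le hrest
  have hlim : Tendsto (fun ε : ℝ => (absFunctional F f₁ : ℝ) + absFunctional F f₂ + ‖F‖ * ε)
      (𝓝[>] 0) (𝓝 (absFunctional F f₁ + absFunctional F f₂ + ‖F‖ * 0)) :=
    ((continuous_const.add (continuous_const.mul continuous_id)).tendsto 0).mono_left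
      nhdsWithin_le_nhds
  rw [mul_zero, add_zero] at hlim
  have := ge_of_tendsto hlim (eventually_mem_nhdsWithin.mono key)
  exact_mod_cast this

theorem le_absFunctional_add (f₁ f₂ : C_c(X, ℝ≥0)) :
    absFunctional F f₁ + absFunctional F f₂ ≤ absFunctional F (f₁ + f₂) := by
  suffices h : ∀ g₁ g₂ : X →ᵇ ℂ, (∀ x, ‖g₁ x‖₊ ≤ f₁ x) → (∀ x, ‖g₂ x‖₊ ≤ f₂ x) →
      ‖F g₁‖₊ + ‖F g₂‖₊ ≤ absFunctional F (f₁ + f₂) by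
    have h₁ : ∀ g₁ : X →ᵇ ℂ, (∀ x, ‖g₁ x‖₊ ≤ f₁ x) →
        absFunctional F f₂ + ‖F g₁‖₊ ≤ absFunctional F (f₁ + f₂) := fun g₁ hg₁ => by
      have hle : ‖F g₁‖₊ ≤ absFunctional F (f₁ + f₂) := by
        simpa using h g₁ 0 hg₁ (by simp)
      refine (add_le_add_left (absFunctional_le fun g₂ hg₂ =>
        le_tsub_of_add_le_left (h g₁ g₂ hg₁ hg₂)) _).trans_eq (tsub_add_cancel_of_le hle)
    have hle : absFunctional F f₂ ≤ absFunctional F (f₁ + f₂) := by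
      simpa using h₁ 0 (by simp)
    exact (add_le_add_left (absFunctional_le fun g₁ hg₁ =>
      le_tsub_of_add_le_left (h₁ g₁ hg₁)) _).trans_eq (tsub_add_cancel_of_le hle)
  intro g₁ g₂ hg₁ hg₂
  obtain ⟨c₁, hc₁, h₁⟩ := RCLike.exists_norm_eq_mul_self (F g₁)
  obtain ⟨c₂, hc₂, h₂⟩ := RCLike.exists_norm_eq_mul_self (F g₂)
  have h : ‖F g₁‖₊ + ‖F g₂‖₊ = ‖F (c₁ • g₁ + c₂ • g₂)‖₊ := by
    rw [map_add, map_smul, map_smul, smul_eq_mul, smul_eq_mul, ← h₁, ← h₂]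
    ext
    push_cast
    rw [← RCLike.ofReal_add, RCLike.norm_ofReal, abs_of_nonneg (by positivity)]
  rw [h]
  refine nnnorm_le_absFunctional fun x => ?_
  have hn₁ : ‖c₁‖₊ = 1 := NNReal.eq hc₁
  have hn₂ : ‖c₂‖₊ = 1 := NNReal.eq hc₂
  refine (nnnorm_add_le _ _).trans (add_le_add ?_ ?_)
  · rw [BoundedContinuousFunction.smul_apply, nnnorm_smul, hn₁, one_mul]
    exact hg₁ x
  · rw [BoundedContinuousFunction.smul_apply, nnnorm_smul, hn₂, one_mul]
    exact hg₂ x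

variable (F)

/-- The functional `absFunctional F` as a linear map. -/
noncomputable def absLinear : C_c(X, ℝ≥0) →ₗ[ℝ≥0] ℝ≥0 where
  toFun := absFunctional F
  map_add' f₁ f₂ := (absFunctional_add_le f₁ f₂).antisymm (le_absFunctional_add f₁ f₂)
  map_smul' := absFunctional_smul

variable [T2Space X] [LocallyCompactSpace X] [MeasurableSpace X] [BorelSpace X]

/-- The positive measure representing the absolute value of `F`; it dominates `F` on compactly
supported functions. -/
noncomputable def absMeasure : Measure X :=
  NNRealRMK.rieszMeasure (absLinear F)

theorem absMeasure_univ_le : absMeasure F univ ≤ ‖F‖ₑ := by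
  have : (absMeasure F).Regular := NNRealRMK.rieszMeasure_regular _
  rw [isOpen_univ.measure_eq_iSup_isCompact]
  refine iSup₂_le fun S _ => iSup_le fun hS => ?_
  obtain ⟨f, hf1, -, hfc, hf⟩ := exists_continuous_one_zero_of_isCompact hS isClosed_empty
    (disjoint_empty S)
  let φ : C_c(X, ℝ≥0) := CompactlySupportedContinuousMap.nnrealPart ⟨f, hfc⟩
  have hφ : ∀ x, φ x = (f x).toNNReal := fun x => rfl
  calc absMeasure F S = ∫⁻ x, S.indicator 1 x ∂absMeasure F :=
        (lintegral_indicator_one hS.measurableSet).symm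
    _ ≤ ∫⁻ x, φ x ∂absMeasure F := by
        refine lintegral_mono fun x => ?_
        by_cases hx : x ∈ S
        · simp [hx, hφ, hf1 hx]
        · simp [hx]
    _ = absFunctional F φ := NNRealRMK.lintegral_rieszMeasure _ φ
    _ ≤ ‖F‖ₑ := by
        refine ENNReal.coe_le_coe.2 (absFunctional_le fun g hg => ?_)
        have hg1 : ‖g‖ ≤ 1 := (BoundedContinuousFunction.norm_le zero_le_one).2 fun x => by
          have h1 : φ x ≤ 1 := by simpa [hφ] using (hf x).2
          exact_mod_cast (hg x).trans h1
        exact (F.le_opNorm_of_le hg1).trans_eq (mul_one _)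

instance : IsFiniteMeasure (absMeasure F) :=
  ⟨(absMeasure_univ_le F).trans_lt enorm_lt_top⟩

theorem norm_le_integral_absMeasure {g : X →ᵇ ℂ} (hg : HasCompactSupport g) :
    ‖F g‖ ≤ ∫ x, ‖g x‖ ∂absMeasure F := by
  let φ : C_c(X, ℝ≥0) := ⟨⟨fun x => ‖g x‖₊, by fun_prop⟩, hg.comp_left nnnorm_zero⟩
  have h : ∫ x, (φ x : ℝ) ∂absMeasure F = absFunctional F φ :=
    NNRealRMK.integral_rieszMeasure (absLinear F) φ
  refine le_trans ?_ h.ge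
  exact nnnorm_le_absFunctional fun x => le_rfl

/-- The subspace of compactly supported functions. -/
def compactlySupported (X : Type*) [TopologicalSpace X] : Submodule ℂ (X →ᵇ ℂ) where
  carrier := {g | HasCompactSupport g}
  add_mem' hf hg := HasCompactSupport.add hf hg
  zero_mem' := HasCompactSupport.zero
  smul_mem' c _ hf := hf.smul_left (f := fun _ => c)

theorem exists_dual_L1 :
    ∃ L : (X →₁[absMeasure F] ℂ) →L[ℂ] ℂ, ‖L‖ ≤ 1 ∧
      ∀ g ∈ closure (compactlySupported X : Set (X →ᵇ ℂ)),
        L (BoundedContinuousFunction.toLp 1 (absMeasure F) ℂ g) = F g := by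
  obtain ⟨L, hL, hLF⟩ := exists_dual_comp_eq
    ((BoundedContinuousFunction.toLp (E := ℂ) 1 (absMeasure F) ℂ).toLinearMap ∘ₗ
      (compactlySupported X).subtype) (F.toLinearMap ∘ₗ (compactlySupported X).subtype)
    zero_le_one fun g => by
      rw [one_mul, L1.norm_eq_integral_norm]
      refine (norm_le_integral_absMeasure F g.2).trans_eq (integral_congr_ae ?_)
      filter_upwards [BoundedContinuousFunction.coeFn_toLp 1 (absMeasure F) ℂ g.1] with x hx
      rw [← hx]
      rfl
  refine ⟨L, hL, fun g hg => ?_⟩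
  refine (isClosed_eq (L.continuous.comp (ContinuousLinearMap.continuous _))
    F.continuous).closure_subset_iff.2 (fun g hg => ?_) hg
  exact hLF ⟨g, hg⟩

end DominatingFunctional

/-- The **Riesz representation theorem** for complex functionals: a bounded functional on the
bounded continuous functions is represented, on the closure of the compactly supported ones, by a
complex measure of total variation at most `‖F‖`. -/
theorem exists_complexMeasure_eq_cintegral (F : (ℝ≥0 →ᵇ ℂ) →L[ℂ] ℂ) :
    ∃ b : ComplexMeasure ℝ≥0, b.variation univ ≤ ‖F‖ₑ ∧
      ∀ g ∈ closure (compactlySupported ℝ≥0 : Set (ℝ≥0 →ᵇ ℂ)), F g = cintegral b g := by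
  classical
  set μ := absMeasure F
  obtain ⟨L, hL, hLF⟩ : ∃ L : (ℝ≥0 →₁[μ] ℂ) →L[ℂ] ℂ, ‖L‖ ≤ 1 ∧
    ∀ g ∈ closure (compactlySupported ℝ≥0 : Set (ℝ≥0 →ᵇ ℂ)),
      L (BoundedContinuousFunction.toLp 1 μ ℂ g) = F g := exists_dual_L1 F
  let m : Set ℝ≥0 → ℂ := fun s =>
    if hs : MeasurableSet s then L (indicatorConstLp 1 hs (measure_ne_top μ s) 1) else 0
  have hm : ∀ s (hs : MeasurableSet s),
      m s = L (indicatorConstLp 1 hs (measure_ne_top μ s) 1) := fun s hs => dif_pos hs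
  have hle : ∀ s, ‖m s‖ₑ ≤ μ s := fun s => by
    by_cases hs : MeasurableSet s
    · rw [hm s hs, ← ofReal_norm, ← ofReal_measureReal (measure_ne_top μ s)]
      refine ENNReal.ofReal_le_ofReal ((L.le_of_opNorm_le hL _).trans ?_)
      rw [one_mul, norm_indicatorConstLp one_ne_zero ENNReal.one_ne_top]
      simp
    · simp [m, hs]
  let b : ComplexMeasure ℝ≥0 := VectorMeasure.of_additive_of_le_measure m hle
    (fun s t hs ht hst => by
      rw [hm _ (hs.union ht), hm s hs, hm t ht, ← map_add,
        indicatorConstLp_disjoint_union hs ht (measure_ne_top μ s) (measure_ne_top μ t) hst])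
    fun s hs => dif_neg hs
  have hb : ∀ s, b s = m s := fun s => rfl
  have hbμ : b.variation ≤ μ := VectorMeasure.variation_le_of_forall_enorm_le fun s _ => hle s
  refine ⟨b, (hbμ univ).trans (absMeasure_univ_le F), fun g hg => ?_⟩
  rw [← hLF g hg, eq_cintegral_of_indicator hbμ L fun c s hs hμs => ?_]
  · exact VectorMeasure.integral_congr_ae ((Measure.absolutelyContinuous_of_le hbμ).ae_eq
      (BoundedContinuousFunction.coeFn_toLp 1 μ ℂ g))
  · have : indicatorConstLp 1 hs hμs.ne c = c • indicatorConstLp 1 hs hμs.ne (1 : ℂ) := by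
      refine Lp.ext ?_
      filter_upwards [indicatorConstLp_coeFn (p := 1) (hs := hs) (hμs := hμs.ne) (c := c),
        indicatorConstLp_coeFn (p := 1) (hs := hs) (hμs := hμs.ne) (c := (1 : ℂ)),
        Lp.coeFn_smul c (indicatorConstLp 1 hs hμs.ne (1 : ℂ))] with x h1 h2 h3
      rw [h1, h3, Pi.smul_apply, h2]
      by_cases hx : x ∈ s <;> simp [hx]
    rw [this, map_smul, hb, hm s hs, smul_eq_mul, smul_eq_mul, mul_comm]

/-! ### Integrability against the Lévy measure -/

section LevyKernel

variable {ψ : ℝ → ℝ} {ρ : Measure ℝ≥0}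

theorem HasLevyRepr.integrable_inv_max (hρ : HasLevyRepr ψ ρ) :
    Integrable (fun u : ℝ≥0 => (max 1 (u : ℝ))⁻¹) ρ := by
  have hmeas : Measurable fun u : ℝ≥0 => (max 1 (u : ℝ))⁻¹ := by fun_prop
  have h1 : IntegrableOn (fun u : ℝ≥0 => (max 1 (u : ℝ))⁻¹) (Icc 0 1) ρ :=
    IntegrableOn.of_bound hρ.measure_Icc_lt_top hmeas.aestronglyMeasurable 1
      (Eventually.of_forall fun u => by
        rw [Real.norm_of_nonneg (by positivity)]
        exact inv_le_one_of_one_le₀ (le_max_left _ _))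
  have h2 : IntegrableOn (fun u : ℝ≥0 => (max 1 (u : ℝ))⁻¹) (Ici 1) ρ := by
    refine ⟨hmeas.aestronglyMeasurable, ?_⟩
    rw [hasFiniteIntegral_iff_enorm]
    refine lt_of_le_of_lt (setLIntegral_mono' measurableSet_Ici fun u hu => ?_)
      hρ.lintegral_Ici_lt_top
    have hu0 : u ≠ 0 := (zero_lt_one.trans_le hu).ne'
    have hu1 : (1 : ℝ) ≤ u := hu
    rw [max_eq_right hu1, ← ENNReal.coe_inv hu0, ← NNReal.coe_inv, ← ofReal_norm,
      Real.norm_of_nonneg (NNReal.coe_nonneg _), ENNReal.ofReal_coe_nnreal]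
  rw [← integrableOn_univ, show (univ : Set ℝ≥0) = Icc 0 1 ∪ Ici 1 by ext u; simp]
  exact h1.union h2

theorem HasLevyRepr.integrable_of_norm_le {E : Type*} [NormedAddCommGroup E]
    (hρ : HasLevyRepr ψ ρ) {f : ℝ≥0 → E} (hf : AEStronglyMeasurable f ρ) {C : ℝ}
    (hC : ∀ u : ℝ≥0, ‖f u‖ ≤ C * (max 1 (u : ℝ))⁻¹) : Integrable f ρ :=
  (hρ.integrable_inv_max.const_mul C).mono' hf (Eventually.of_forall hC)

/-- A quotient is of order `min(1, 1/u)` as soon as its numerator is bounded and is of order `u`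
near `0`. -/
theorem norm_inv_smul_le_inv_max {E : Type*} [NormedAddCommGroup E] [NormedSpace ℝ E] {C : ℝ}
    {u : ℝ≥0} {x : E} (hu : u ≠ 0) (hx : ‖x‖ ≤ C) (hxu : u ≤ 1 → ‖x‖ ≤ C * u) :
    ‖(u : ℝ)⁻¹ • x‖ ≤ C * (max 1 (u : ℝ))⁻¹ := by
  have hu0 : (0 : ℝ) < u := by positivity
  rw [norm_smul, norm_inv, Real.norm_of_nonneg u.coe_nonneg]
  rcases le_total u 1 with h | h
  · have h' : (u : ℝ) ≤ 1 := h
    rw [max_eq_left h', inv_one, mul_one, inv_mul_le_iff₀ hu0, mul_comm]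
    exact hxu h
  · have h' : (1 : ℝ) ≤ u := h
    rw [max_eq_right h', mul_comm]
    exact mul_le_mul_of_nonneg_right hx (by positivity)

theorem abs_levyKernel_le {s : ℝ} (hs : s ≤ 0) (u : ℝ≥0) :
    ‖levyKernel s u‖ ≤ (1 + |s|) * (max 1 (u : ℝ))⁻¹ := by
  by_cases hu : u = 0
  · subst hu
    simp [levyKernel]
  · have hsu : s * u ≤ 0 := mul_nonpos_of_nonpos_of_nonneg hs u.coe_nonneg
    have habs : ‖Real.exp (s * u) - 1‖ = 1 - Real.exp (s * u) := by
      rw [Real.norm_of_nonpos (by linarith [Real.exp_le_one_iff.2 hsu])]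
      ring
    rw [levyKernel, if_neg hu, mul_comm, ← smul_eq_mul]
    refine norm_inv_smul_le_inv_max hu ?_ fun _ => ?_
    · rw [habs]
      linarith [Real.exp_pos (s * u), abs_nonneg s]
    · rw [habs]
      have h1 := Real.add_one_le_exp (s * u)
      have h2 := neg_abs_le s
      nlinarith [u.coe_nonneg, mul_nonneg (abs_nonneg s) u.coe_nonneg]

theorem measurable_levyKernel (s : ℝ) : Measurable (levyKernel s) :=
  Measurable.ite (measurableSet_singleton 0) measurable_const (by fun_prop)

theorem HasLevyRepr.integrable_levyKernel (hρ : HasLevyRepr ψ ρ) {s : ℝ} (hs : s ≤ 0) :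
    Integrable (levyKernel s) ρ :=
  hρ.integrable_of_norm_le (measurable_levyKernel s).aestronglyMeasurable (abs_levyKernel_le hs)

end LevyKernel

/-! ### The functional defining `K(a, ρ)` and its representing measure -/

section ExponentialSums

variable {a b : ComplexMeasure ℝ≥0} {ψ : ℝ → ℝ} {ρ : Measure ℝ≥0}

/-- The exponential polynomial on `ℝ` with coefficients `c`. -/
noncomputable def expSum (c : Iio (0 : ℝ) →₀ ℂ) (t : ℝ) : ℂ :=
  ∑ s ∈ c.support, c s * Complex.exp (((s : ℝ) : ℂ) * (t : ℂ))

theorem expSum_eq_sum_expFun (c : Iio (0 : ℝ) →₀ ℂ) (t : ℝ≥0) :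
    expSum c t = ∑ s ∈ c.support, c s * expFun s t := rfl

theorem mem_expPoly_iff {φ : ℝ → ℂ} : φ ∈ expPoly ↔ ∃ c, φ = expSum c := by
  have hset : {φ : ℝ → ℂ | ∃ s : ℝ, s < 0 ∧ φ = fun t : ℝ => Complex.exp ((s : ℂ) * (t : ℂ))}
      = range fun (s : Iio (0 : ℝ)) (t : ℝ) => Complex.exp (((s : ℝ) : ℂ) * (t : ℂ)) := by
    ext φ
    constructor
    · rintro ⟨s, hs, rfl⟩
      exact ⟨⟨s, hs⟩, rfl⟩
    · rintro ⟨s, rfl⟩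
      exact ⟨s, s.2, rfl⟩
  rw [expPoly, hset, Finsupp.mem_span_range_iff_exists_finsupp]
  refine exists_congr fun c => ?_
  have : (c.sum fun s z => z • fun t : ℝ => Complex.exp (((s : ℝ) : ℂ) * (t : ℂ))) = expSum c := by
    funext t
    simp [Finsupp.sum, expSum, Finset.sum_apply]
  rw [this, eq_comm]

theorem hasDerivAt_expSum (c : Iio (0 : ℝ) →₀ ℂ) (t : ℝ) :
    HasDerivAt (expSum c)
      (∑ s ∈ c.support, c s * ((s : ℝ) * Complex.exp (((s : ℝ) : ℂ) * (t : ℂ)))) t := by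
  refine HasDerivAt.fun_sum fun s _ => ?_
  have h : HasDerivAt (fun t : ℝ => ((s : ℝ) : ℂ) * (t : ℂ)) ((s : ℝ) : ℂ) t := by
    simpa using (Complex.ofRealCLM.hasDerivAt (x := t)).const_mul ((s : ℝ) : ℂ)
  refine (h.cexp.const_mul (c s)).congr_deriv ?_
  ring

theorem continuous_expSum (c : Iio (0 : ℝ) →₀ ℂ) : Continuous (expSum c) :=
  continuous_iff_continuousAt.2 fun t => (hasDerivAt_expSum c t).continuousAt

theorem cintegral_sum_expFun (c : Iio (0 : ℝ) →₀ ℂ) (z : Iio (0 : ℝ) → ℂ) :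
    (cintegral a fun r => ∑ s ∈ c.support, c s * (z s * expFun s r))
      = ∑ s ∈ c.support, c s * (z s * laplace a s) := by
  rw [cintegral_finset_sum _ fun s _ =>
    ((integrable_expFun (le_of_lt s.2)).const_mul _).const_mul _]
  refine Finset.sum_congr rfl fun s _ => ?_
  have h1 := cintegral_const_smul (a := a) (c s * z s) (expFun s)
  simp only [smul_eq_mul, mul_assoc] at h1
  exact h1

/-- The exponential `e_s` as a bounded continuous function on `ℝ₊`. -/
noncomputable def expBounded (s : Iio (0 : ℝ)) : ℝ≥0 →ᵇ ℂ :=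
  BoundedContinuousFunction.ofNormedAddCommGroup (expFun s) (continuous_expFun s) 1
    (norm_expFun_le_one (le_of_lt s.2))

theorem linearCombination_expBounded_apply (c : Iio (0 : ℝ) →₀ ℂ) (t : ℝ≥0) :
    Finsupp.linearCombination ℂ expBounded c t = expSum c t := by
  rw [Finsupp.linearCombination_apply, Finsupp.sum, BoundedContinuousFunction.coe_sum,
    Finset.sum_apply]
  rfl

theorem iSup_norm_expSum (c : Iio (0 : ℝ) →₀ ℂ) :
    ⨆ t : ℝ≥0, ‖expSum c t‖ = ‖Finsupp.linearCombination ℂ expBounded c‖ := by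
  rw [BoundedContinuousFunction.norm_eq_iSup_norm]
  exact iSup_congr fun t => by rw [linearCombination_expBounded_apply]

theorem norm_expSum_le (c : Iio (0 : ℝ) →₀ ℂ) (t : ℝ≥0) :
    ‖expSum c t‖ ≤ ‖Finsupp.linearCombination ℂ expBounded c‖ := by
  rw [← linearCombination_expBounded_apply]
  exact BoundedContinuousFunction.norm_coe_le_norm _ t

theorem translationQuotient_expSum (c : Iio (0 : ℝ) →₀ ℂ) (u : ℝ≥0) :
    translationQuotient a (expSum c) u
      = ∑ s ∈ c.support, c s * ((levyKernel s u : ℂ) * laplace a s) := by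
  by_cases hu : u = 0
  · subst hu
    simp only [translationQuotient, levyKernel, if_true]
    rw [← cintegral_sum_expFun]
    congr 1
    funext r
    rw [(hasDerivAt_expSum c r).deriv]
    rfl
  · have hcont : Continuous fun r : ℝ≥0 => expSum c r :=
      (continuous_expSum c).comp NNReal.continuous_coe
    rw [translationQuotient, if_neg hu, cintegral_translationDiff u hcont (norm_expSum_le c)]
    have h : (fun r : ℝ≥0 => expSum c ((r + u : ℝ≥0) : ℝ) - expSum c r)
        = fun r => ∑ s ∈ c.support, c s * ((expFun s u - 1) * expFun s r) := by
      funext r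
      rw [expSum_eq_sum_expFun, expSum_eq_sum_expFun, ← Finset.sum_sub_distrib]
      refine Finset.sum_congr rfl fun s _ => ?_
      rw [expFun_add]
      ring
    rw [h, cintegral_sum_expFun, Finset.sum_mul]
    refine Finset.sum_congr rfl fun s _ => ?_
    rw [levyKernel, if_neg hu, expFun_eq_ofReal]
    push_cast
    ring

theorem integral_translationQuotient_expSum (hψ : ψ 0 = 0) (hρ : HasLevyRepr ψ ρ)
    (c : Iio (0 : ℝ) →₀ ℂ) :
    ∫ u, translationQuotient a (expSum c) u ∂ρ
      = Finsupp.linearCombination ℂ (fun s : Iio (0 : ℝ) => (ψ s : ℂ) * laplace a s) c := by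
  simp_rw [translationQuotient_expSum]
  rw [integral_finsetSum _ fun s _ =>
    (((hρ.integrable_levyKernel (le_of_lt s.2)).ofReal).mul_const _).const_mul _,
    Finsupp.linearCombination_apply, Finsupp.sum]
  refine Finset.sum_congr rfl fun s _ => ?_
  rw [integral_const_mul, integral_mul_const, integral_complex_ofReal,
    hρ.eq_integral s (le_of_lt s.2), hψ, zero_add, smul_eq_mul]

/-- The translation quotient depends only on the restriction of `φ` to `ℝ₊`: the derivative in its
value at `u = 0` is two-sided at the origin, but it is determined by the right derivative. -/
theorem translationQuotient_eq_zero {φ : ℝ → ℂ} (hφ : ∀ t : ℝ≥0, φ t = 0)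
    (hd : Differentiable ℝ φ) (u : ℝ≥0) : translationQuotient a φ u = 0 := by
  have hderiv : ∀ r : ℝ≥0, deriv φ r = 0 := fun r => by
    have h1 : HasDerivWithinAt φ (deriv φ r) (Ici (r : ℝ)) r :=
      (hd r).hasDerivAt.hasDerivWithinAt
    have h2 : HasDerivWithinAt φ 0 (Ici (r : ℝ)) r := by
      refine (hasDerivWithinAt_const (r : ℝ) (Ici (r : ℝ)) (0 : ℂ)).congr (fun t ht => ?_) (hφ r)
      exact hφ ⟨t, r.coe_nonneg.trans ht⟩
    exact (uniqueDiffOn_Ici (r : ℝ) _ self_mem_Ici).eq_deriv _ h1 h2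
  unfold translationQuotient
  simp only [hφ, hderiv, cintegral_zero, zero_mul, ite_self]

/-- The functional `e_s ↦ ψ(s) g(s)` has norm at most `K(a, ρ)` on the exponential sums. -/
theorem norm_linearCombination_le_K (hψ : ψ 0 = 0) (hρ : HasLevyRepr ψ ρ) (hK : K a ρ < ∞)
    (c : Iio (0 : ℝ) →₀ ℂ) :
    ‖Finsupp.linearCombination ℂ (fun s : Iio (0 : ℝ) => (ψ s : ℂ) * laplace a s) c‖
      ≤ (K a ρ).toReal * ‖Finsupp.linearCombination ℂ expBounded c‖ := by
  set m := ‖Finsupp.linearCombination ℂ expBounded c‖ with hm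
  rcases eq_or_ne m 0 with h0 | h0
  -- A sum of norm `0` cannot be normalized, but it vanishes on `ℝ₊`.
  · have hφ : ∀ t : ℝ≥0, expSum c t = 0 := fun t =>
      norm_le_zero_iff.1 ((norm_expSum_le c t).trans_eq h0)
    rw [← integral_translationQuotient_expSum hψ hρ]
    simp only [translationQuotient_eq_zero hφ fun t => (hasDerivAt_expSum c t).differentiableAt]
    simp [h0]
  · have hm0 : 0 < m := lt_of_le_of_ne (norm_nonneg _) h0.symm
    have hmem : expSum ((m⁻¹ : ℂ) • c) ∈ expPolySphere := by
      refine ⟨mem_expPoly_iff.2 ⟨_, rfl⟩, ?_⟩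
      rw [iSup_norm_expSum, map_smul, norm_smul, ← hm, norm_inv, Complex.norm_real, norm_norm,
        inv_mul_cancel₀ h0]
    have hle : ‖∫ u, translationQuotient a (expSum ((m⁻¹ : ℂ) • c)) u ∂ρ‖ₑ ≤ K a ρ :=
      le_iSup₂ (f := fun φ (_ : φ ∈ expPolySphere) => ‖∫ u, translationQuotient a φ u ∂ρ‖ₑ) _ hmem
    have h1 := ENNReal.toReal_mono hK.ne hle
    rw [toReal_enorm, integral_translationQuotient_expSum hψ hρ, map_smul, norm_smul, norm_inv,
      Complex.norm_real, norm_norm, inv_mul_le_iff₀ hm0] at h1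
    rwa [mul_comm]

theorem expBounded_mem_closure (s : Iio (0 : ℝ)) :
    expBounded s ∈ closure (compactlySupported ℝ≥0 : Set (ℝ≥0 →ᵇ ℂ)) := by
  have hs : (s : ℝ) < 0 := s.2
  rw [Metric.mem_closure_iff]
  intro ε hε
  obtain ⟨n, hn⟩ : ∃ n : ℕ, Real.exp (s * n) < ε := by
    have h : Tendsto (fun n : ℕ => Real.exp (s * n)) atTop (𝓝 0) :=
      Real.tendsto_exp_atBot.comp
        (tendsto_natCast_atTop_atTop.const_mul_atTop_of_neg hs)
    exact (h.eventually (gt_mem_nhds hε)).exists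
  let χ : ℝ≥0 → ℝ := fun t => max 0 (min 1 (n + 1 - t))
  have hχ0 : ∀ t, 0 ≤ χ t := fun t => le_max_left _ _
  have hχ1 : ∀ t, χ t ≤ 1 := fun t => max_le zero_le_one (min_le_left _ _)
  let g : ℝ≥0 →ᵇ ℂ := BoundedContinuousFunction.ofNormedAddCommGroup
    (fun t => (χ t : ℂ) * expFun s t)
    ((Complex.continuous_ofReal.comp (by fun_prop)).mul (continuous_expFun s)) 1 fun t => by
      rw [norm_mul, Complex.norm_real, Real.norm_of_nonneg (hχ0 t)]
      exact mul_le_one₀ (hχ1 t) (norm_nonneg _) (norm_expFun_le_one hs.le t)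
  refine ⟨g, ?_, ?_⟩
  · refine HasCompactSupport.intro (isCompact_Icc (a := (0 : ℝ≥0)) (b := n + 1)) fun t ht => ?_
    have ht' : (n : ℝ) + 1 < t := by
      have : (n : ℝ≥0) + 1 < t := by simpa using ht
      exact_mod_cast this
    have : χ t = 0 := max_eq_left ((min_le_right _ _).trans (by linarith))
    simp [g, this]
  · refine lt_of_le_of_lt ((BoundedContinuousFunction.dist_le (Real.exp_pos _).le).2 fun t => ?_) hn
    have hd : expBounded s t - g t = ((1 - χ t : ℝ) : ℂ) * expFun s t := by
      change expFun s t - (χ t : ℂ) * expFun s t = _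
      push_cast
      ring
    rw [dist_eq_norm, hd, norm_mul, Complex.norm_real, norm_expFun,
      Real.norm_of_nonneg (by linarith [hχ1 t])]
    rcases le_total (t : ℝ) n with ht | ht
    · have : χ t = 1 := by
        simp only [χ]
        rw [min_eq_left (by linarith), max_eq_right zero_le_one]
      rw [this, sub_self, zero_mul]
      exact (Real.exp_pos _).le
    · calc (1 - χ t) * Real.exp (s * t) ≤ 1 * Real.exp (s * n) := by
            refine mul_le_mul (by linarith [hχ0 t]) ?_ (Real.exp_pos _).le zero_le_one
            exact Real.exp_le_exp.2 (mul_le_mul_of_nonpos_left ht hs.le)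
        _ = _ := one_mul _

theorem tendsto_laplace_zero {σ : ℕ → ℝ} (hσ : ∀ n, σ n ≤ 0) (hlim : Tendsto σ atTop (𝓝 0)) :
    Tendsto (fun n => laplace a (σ n)) atTop (𝓝 (laplace a 0)) := by
  refine tendsto_cintegral (fun n => continuous_expFun (σ n))
    (fun n => norm_expFun_le_one (hσ n)) fun u => ?_
  have h : Continuous fun s : ℝ => expFun s u := by
    unfold expFun
    fun_prop
  exact (h.tendsto 0).comp hlim

theorem exists_laplace_eq_mul_laplace (hψ : IsNegBernsteinZero ψ) (hρ : HasLevyRepr ψ ρ)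
    (hK : K a ρ < ∞) :
    ∃ b : ComplexMeasure ℝ≥0, (∀ s ≤ 0, (ψ s : ℂ) * laplace a s = laplace b s) ∧
      b.variation univ ≤ K a ρ := by
  obtain ⟨F, hF, hFG⟩ := exists_dual_comp_eq (Finsupp.linearCombination ℂ expBounded)
    (Finsupp.linearCombination ℂ fun s : Iio (0 : ℝ) => (ψ s : ℂ) * laplace a s)
    ENNReal.toReal_nonneg (norm_linearCombination_le_K hψ.map_zero hρ hK)
  obtain ⟨b, hb, hbF⟩ := exists_complexMeasure_eq_cintegral F
  have hneg : ∀ s < 0, (ψ s : ℂ) * laplace a s = laplace b s := fun s hs => by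
    have h1 := hFG (Finsupp.single ⟨s, hs⟩ 1)
    rw [Finsupp.linearCombination_single, Finsupp.linearCombination_single, one_smul,
      one_smul, hbF _ (expBounded_mem_closure _)] at h1
    exact h1.symm
  refine ⟨b, fun s hs => ?_, hb.trans ?_⟩
  · rcases hs.lt_or_eq with hs | rfl
    · exact hneg s hs
    -- The identity extends to `s = 0` by continuity from the left.
    let σ : ℕ → ℝ := fun n => -(1 / ((n : ℝ) + 1))
    have hσ : ∀ n, σ n < 0 := fun n => neg_neg_of_pos (by positivity)
    have hlim : Tendsto σ atTop (𝓝 0) := by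
      have h := (tendsto_one_div_add_atTop_nhds_zero_nat (𝕜 := ℝ)).neg
      rwa [neg_zero] at h
    have hψlim : Tendsto (fun n => ψ (σ n)) atTop (𝓝 (ψ 0)) :=
      (hψ.continuousOn 0 self_mem_Iic).tendsto.comp
        (tendsto_nhdsWithin_iff.2 ⟨hlim, Eventually.of_forall fun n => (hσ n).le⟩)
    have h1 := ((Complex.continuous_ofReal.tendsto _).comp hψlim).mul
      (tendsto_laplace_zero (a := a) (fun n => (hσ n).le) hlim)
    refine tendsto_nhds_unique (h1.congr fun n => ?_)
      (tendsto_laplace_zero (a := b) (fun n => (hσ n).le) hlim)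
    exact hneg _ (hσ n)
  · rw [← ofReal_norm]
    exact ENNReal.ofReal_le_of_le_toReal hF

theorem K_le_variation (hψ : ψ 0 = 0) (hρ : HasLevyRepr ψ ρ)
    (hb : ∀ s ≤ 0, (ψ s : ℂ) * laplace a s = laplace b s) : K a ρ ≤ b.variation univ := by
  refine iSup₂_le fun φ hφ => ?_
  obtain ⟨c, rfl⟩ := mem_expPoly_iff.1 hφ.1
  have h1 : ∫ u, translationQuotient a (expSum c) u ∂ρ = cintegral b fun t => expSum c t := by
    have h2 := cintegral_sum_expFun (a := b) c fun _ => 1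
    simp only [one_mul] at h2
    rw [integral_translationQuotient_expSum hψ hρ]
    refine Eq.trans ?_ h2.symm
    rw [Finsupp.linearCombination_apply, Finsupp.sum]
    exact Finset.sum_congr rfl fun s _ => by rw [hb s (le_of_lt s.2), smul_eq_mul]
  have h3 : ∀ t : ℝ≥0, ‖expSum c t‖ ≤ 1 := fun t => by
    rw [← hφ.2, iSup_norm_expSum]
    exact norm_expSum_le c t
  have h4 := norm_cintegral_le (a := b) h3
  rw [one_mul] at h4
  rw [h1, ← ofReal_norm]
  exact ENNReal.ofReal_le_of_le_toReal h4

end ExponentialSums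

/-! ### Exponential averages of bounded functions -/

section ExponentialAverage

variable {E : Type*} [NormedAddCommGroup E] [NormedSpace ℂ E] {l C : ℝ} {k : ℝ≥0 → E}

/-- The resolvent at `l > 0` of the translation semigroup on functions on `ℝ₊`,
`t ↦ ∫_{v > 0} e^{-lv} k(t + v) dv`. -/
noncomputable def expAverage (l : ℝ) (k : ℝ≥0 → E) (t : ℝ≥0) : E :=
  ∫ v in Ioi (0 : ℝ), Real.exp (-l * v) • k (t + v.toNNReal)

theorem integral_exp_neg_mul_Ioi_zero (hl : 0 < l) :
    ∫ v in Ioi (0 : ℝ), Real.exp (-l * v) = l⁻¹ := by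
  rw [integral_exp_mul_Ioi (neg_neg_of_pos hl)]
  simp

theorem continuous_exp_smul (hk : Continuous k) (t : ℝ≥0) :
    Continuous fun v : ℝ => Real.exp (-l * v) • k (t + v.toNNReal) := by
  fun_prop

theorem norm_exp_smul_le (hC : ∀ t, ‖k t‖ ≤ C) (t : ℝ≥0) (v : ℝ) :
    ‖Real.exp (-l * v) • k (t + v.toNNReal)‖ ≤ C * Real.exp (-l * v) := by
  rw [norm_smul, Real.norm_of_nonneg (Real.exp_pos _).le, mul_comm]
  exact mul_le_mul_of_nonneg_right (hC _) (Real.exp_pos _).le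

theorem integrableOn_exp_smul (hl : 0 < l) (hk : Continuous k) (hC : ∀ t, ‖k t‖ ≤ C) (t : ℝ≥0) :
    IntegrableOn (fun v : ℝ => Real.exp (-l * v) • k (t + v.toNNReal)) (Ioi 0) :=
  ((exp_neg_integrableOn_Ioi 0 hl).const_mul C).mono'
    (continuous_exp_smul hk t).aestronglyMeasurable
    (Eventually.of_forall (norm_exp_smul_le hC t))

theorem norm_expAverage_le (hl : 0 < l) (hC : ∀ t, ‖k t‖ ≤ C) (t : ℝ≥0) :
    ‖expAverage l k t‖ ≤ C * l⁻¹ := by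
  refine (norm_integral_le_of_norm_le ((exp_neg_integrableOn_Ioi 0 hl).const_mul C)
    (Eventually.of_forall (norm_exp_smul_le hC t))).trans_eq ?_
  rw [integral_const_mul, integral_exp_neg_mul_Ioi_zero hl]

theorem continuous_expAverage (hl : 0 < l) (hk : Continuous k) (hC : ∀ t, ‖k t‖ ≤ C) :
    Continuous (expAverage l k) :=
  continuous_of_dominated (fun t => (continuous_exp_smul hk t).aestronglyMeasurable)
    (fun t => Eventually.of_forall (norm_exp_smul_le hC t))
    ((exp_neg_integrableOn_Ioi 0 hl).const_mul C) (Eventually.of_forall fun _ => by fun_prop)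

theorem tendsto_expAverage (hl : 0 < l) {κ : ℕ → ℝ≥0 → E} (hκ : ∀ n, Continuous (κ n))
    (hC : ∀ n t, ‖κ n t‖ ≤ C) (hlim : ∀ t, Tendsto (fun n => κ n t) atTop (𝓝 (k t))) (t : ℝ≥0) :
    Tendsto (fun n => expAverage l (κ n) t) atTop (𝓝 (expAverage l k t)) :=
  tendsto_integral_of_dominated_convergence _
    (fun n => (continuous_exp_smul (hκ n) t).aestronglyMeasurable)
    ((exp_neg_integrableOn_Ioi 0 hl).const_mul C)
    (fun n => Eventually.of_forall (norm_exp_smul_le (hC n) t))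
    (Eventually.of_forall fun _ => (hlim _).const_smul _)

theorem expAverage_add {k₁ k₂ : ℝ≥0 → E} (hl : 0 < l) (h₁ : Continuous k₁) (h₂ : Continuous k₂)
    {C₁ C₂ : ℝ} (hC₁ : ∀ t, ‖k₁ t‖ ≤ C₁) (hC₂ : ∀ t, ‖k₂ t‖ ≤ C₂) (t : ℝ≥0) :
    expAverage l (k₁ + k₂) t = expAverage l k₁ t + expAverage l k₂ t := by
  simp only [expAverage, Pi.add_apply, smul_add]
  exact integral_add (integrableOn_exp_smul hl h₁ hC₁ t) (integrableOn_exp_smul hl h₂ hC₂ t)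

theorem expAverage_smul (c : ℂ) (t : ℝ≥0) : expAverage l (c • k) t = c • expAverage l k t := by
  simp only [expAverage, Pi.smul_apply, smul_comm _ c]
  exact integral_smul c _

theorem expAverage_comp_comm [CompleteSpace E] (hl : 0 < l) (hk : Continuous k)
    (hC : ∀ t, ‖k t‖ ≤ C) {F : Type*} [NormedAddCommGroup F] [NormedSpace ℂ F] [CompleteSpace F]
    (L : E →L[ℂ] F) (t : ℝ≥0) :
    expAverage l (fun r => L (k r)) t = L (expAverage l k t) := by
  unfold expAverage
  rw [← L.integral_comp_comm (integrableOn_exp_smul hl hk hC t)]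
  simp only [← Complex.coe_smul, map_smul]

/-- An exponential average solves `f' = l f - k`; this is its integrated form. -/
theorem expAverage_add_right (hl : 0 < l) (hk : Continuous k) (hC : ∀ t, ‖k t‖ ≤ C)
    (t u : ℝ≥0) :
    expAverage l k (t + u) = Real.exp (l * u) •
      (expAverage l k t - ∫ v in (0 : ℝ)..u, Real.exp (-l * v) • k (t + v.toNNReal)) := by
  set G : ℝ → E := fun v => Real.exp (-l * v) • k (t + v.toNNReal) with hG
  have hint := integrableOn_exp_smul hl hk hC t
  have hsplit : expAverage l k t = (∫ v in (0 : ℝ)..u, G v) + ∫ v in Ioi (u : ℝ), G v := by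
    rw [intervalIntegral.integral_of_le u.coe_nonneg, ← setIntegral_union Ioc_disjoint_Ioi_same
      measurableSet_Ioi (hint.mono_set Ioc_subset_Ioi_self)
      (hint.mono_set (Ioi_subset_Ioi u.coe_nonneg)), Ioc_union_Ioi_eq_Ioi u.coe_nonneg]
    rfl
  have hshift := (measurePreserving_add_right volume (u : ℝ)).setIntegral_preimage_emb
    (measurableEmbedding_addRight (u : ℝ)) G (Ioi (u : ℝ))
  rw [preimage_add_const_Ioi, sub_self] at hshift
  rw [hsplit, add_sub_cancel_left, ← hshift, ← integral_smul]
  refine setIntegral_congr_fun measurableSet_Ioi fun v hv => ?_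
  have hv0 : 0 ≤ v := le_of_lt hv
  simp only [hG]
  rw [smul_smul, ← Real.exp_add, Real.toNNReal_add hv0 u.coe_nonneg, Real.toNNReal_coe,
    add_assoc t u, add_comm u]
  congr 2
  ring

theorem norm_expAverage_add_right_sub_le (hl : 0 < l) (hk : Continuous k) (hC : ∀ t, ‖k t‖ ≤ C)
    (t : ℝ≥0) {u : ℝ≥0} (hu : u ≤ 1) :
    ‖expAverage l k (t + u) - expAverage l k t‖ ≤ 2 * Real.exp l * C * u := by
  have hC0 : 0 ≤ C := (norm_nonneg _).trans (hC 0)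
  have hu1 : (u : ℝ) ≤ 1 := hu
  have hlu : 0 ≤ l * u := mul_nonneg hl.le u.coe_nonneg
  have hexp : Real.exp (l * u) ≤ Real.exp l := Real.exp_le_exp.2 (mul_le_of_le_one_right hl.le hu1)
  have hexp1 : Real.exp (l * u) - 1 ≤ l * u * Real.exp l := by
    have h1 := Real.add_one_le_exp (-(l * u))
    have h2 : Real.exp (l * u) * Real.exp (-(l * u)) = 1 := by
      rw [← Real.exp_add, add_neg_cancel, Real.exp_zero]
    nlinarith [Real.exp_pos (l * u), mul_le_mul_of_nonneg_left hexp hlu]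
  have hint : ‖∫ v in (0 : ℝ)..u, Real.exp (-l * v) • k (t + v.toNNReal)‖ ≤ C * u := by
    refine (intervalIntegral.norm_integral_le_of_norm_le_const (C := C) fun v hv => ?_).trans_eq
      (by rw [sub_zero, abs_of_nonneg u.coe_nonneg])
    rw [uIoc_of_le u.coe_nonneg] at hv
    refine (norm_exp_smul_le hC t v).trans (mul_le_of_le_one_right hC0 ?_)
    rw [Real.exp_le_one_iff, neg_mul]
    exact neg_nonpos.2 (mul_nonneg hl.le hv.1.le)
  have hdecomp : expAverage l k (t + u) - expAverage l k t
      = (Real.exp (l * u) - 1) • expAverage l k t - Real.exp (l * u) •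
        ∫ v in (0 : ℝ)..u, Real.exp (-l * v) • k (t + v.toNNReal) := by
    rw [expAverage_add_right hl hk hC, smul_sub, sub_smul, one_smul]
    abel
  have h0 : 0 ≤ Real.exp (l * u) - 1 := by linarith [Real.one_le_exp hlu]
  rw [hdecomp]
  refine (norm_sub_le _ _).trans ?_
  rw [norm_smul, norm_smul, Real.norm_of_nonneg h0, Real.norm_of_nonneg (Real.exp_pos _).le]
  calc (Real.exp (l * u) - 1) * ‖expAverage l k t‖ + Real.exp (l * u) * _
      ≤ (l * u * Real.exp l) * (C * l⁻¹) + Real.exp l * (C * u) := by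
        refine add_le_add ?_ ?_
        · exact mul_le_mul hexp1 (norm_expAverage_le hl hC t) (norm_nonneg _) (by positivity)
        · exact mul_le_mul hexp hint (norm_nonneg _) (Real.exp_pos _).le
    _ = 2 * Real.exp l * C * u := by
        field_simp
        ring

theorem tendsto_inv_smul_expAverage_sub [CompleteSpace E] (hl : 0 < l) (hk : Continuous k)
    (hC : ∀ t, ‖k t‖ ≤ C) (t : ℝ≥0) :
    Tendsto (fun u : ℝ≥0 => (u : ℝ)⁻¹ • (expAverage l k (t + u) - expAverage l k t)) (𝓝[>] 0)
      (𝓝 (l • expAverage l k t - k t)) := by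
  let H : ℝ → E := fun u => Real.exp (l * u) •
    (expAverage l k t - ∫ v in (0 : ℝ)..u, Real.exp (-l * v) • k (t + v.toNNReal))
  have hH : HasDerivAt H (l • expAverage l k t - k t) 0 := by
    have h1 : HasDerivAt (fun u : ℝ => Real.exp (l * u)) l 0 := by
      simpa using ((hasDerivAt_id (0 : ℝ)).const_mul l).exp
    have h2 := ((continuous_exp_smul (l := l) hk t).integral_hasStrictDerivAt 0 0).hasDerivAt
    refine (h1.smul (h2.const_sub (expAverage l k t))).congr_deriv ?_
    simp only [intervalIntegral.integral_same, mul_zero, Real.exp_zero, one_smul, sub_zero,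
      Real.toNNReal_zero, add_zero]
    abel
  have hcoe : Tendsto (fun u : ℝ≥0 => (u : ℝ)) (𝓝[>] 0) (𝓝[≠] 0) := by
    refine tendsto_nhdsWithin_iff.2 ⟨?_, ?_⟩
    · exact (NNReal.continuous_coe.tendsto 0).mono_left nhdsWithin_le_nhds
    · filter_upwards [self_mem_nhdsWithin] with u hu
      exact NNReal.coe_ne_zero.2 (ne_of_gt hu)
  refine (hH.tendsto_slope.comp hcoe).congr fun u => ?_
  have hH0 : H 0 = expAverage l k t := by simp [H]
  rw [Function.comp_apply, slope_def_module, sub_zero, hH0, expAverage_add_right hl hk hC]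

theorem expAverage_expFun_smul [CompleteSpace E] (hl : 0 < l) {s : ℝ} (hs : s ≤ 0) (y : E) :
    expAverage l (fun t => expFun s t • y) = fun t => expFun s t • ((l - s)⁻¹ • y) := by
  funext t
  have h : ∀ v ∈ Ioi (0 : ℝ), Real.exp (-l * v) • expFun s (t + v.toNNReal) • y
      = Real.exp (-(l - s) * v) • expFun s t • y := fun v hv => by
    rw [expFun_add, expFun_eq_ofReal s v.toNNReal, Real.coe_toNNReal v (le_of_lt hv),
      mul_comm (expFun s t), mul_smul, Complex.coe_smul, smul_smul, ← Real.exp_add]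
    congr 2
    ring
  rw [expAverage, setIntegral_congr_fun measurableSet_Ioi h, integral_smul_const,
    integral_exp_neg_mul_Ioi_zero (by linarith), smul_comm]

end ExponentialAverage

/-! ### From exponentials to exponential averages -/

section TransferIdentity

variable {E : Type*} [NormedAddCommGroup E] [NormedSpace ℂ E] {l C : ℝ} {k : ℝ≥0 → E}
  {a b : ComplexMeasure ℝ≥0} {ψ : ℝ → ℝ} {ρ : Measure ℝ≥0}

/-- The quotient `u⁻¹ ∫ (f(r + u) - f(r)) da(r)` for the exponential average `f` of `k`; its value
at `u = 0` is `∫ f' da`, where `f' = l f - k`. -/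
noncomputable def averageQuotient (a : ComplexMeasure ℝ≥0) (l : ℝ) (k : ℝ≥0 → E) (u : ℝ≥0) : E :=
  if u = 0 then cintegral a fun r => l • expAverage l k r - k r
  else (u : ℝ)⁻¹ • cintegral a fun r => expAverage l k (r + u) - expAverage l k r

theorem norm_smul_expAverage_sub_le (hl : 0 < l) (hC : ∀ t, ‖k t‖ ≤ C) (r : ℝ≥0) :
    ‖l • expAverage l k r - k r‖ ≤ 2 * C := by
  refine (norm_sub_le _ _).trans ?_
  rw [norm_smul, Real.norm_of_nonneg hl.le]
  have h1 := mul_le_mul_of_nonneg_left (norm_expAverage_le hl hC r) hl.le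
  rw [mul_left_comm, mul_inv_cancel₀ hl.ne', mul_one] at h1
  linarith [hC r]

theorem norm_expAverage_sub_le (hl : 0 < l) (hC : ∀ t, ‖k t‖ ≤ C) (r u : ℝ≥0) :
    ‖expAverage l k (r + u) - expAverage l k r‖ ≤ 2 * (C * l⁻¹) := by
  refine (norm_sub_le _ _).trans ?_
  linarith [norm_expAverage_le hl hC r, norm_expAverage_le hl hC (r + u)]

/-- The constant in the bounds `min(1, 1/u)` for the difference quotients of an exponential
average. -/
noncomputable def averageBound (l C : ℝ) : ℝ :=
  2 * C + 2 * (C * l⁻¹) + 2 * Real.exp l * C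

theorem averageBound_ge (hl : 0 < l) (hC : 0 ≤ C) :
    2 * C ≤ averageBound l C ∧ 2 * (C * l⁻¹) ≤ averageBound l C ∧
      2 * Real.exp l * C ≤ averageBound l C := by
  have h1 : 0 ≤ 2 * (C * l⁻¹) := by positivity
  have h2 : 0 ≤ 2 * Real.exp l * C := by positivity
  unfold averageBound
  refine ⟨?_, ?_, ?_⟩ <;> linarith

theorem norm_averageQuotient_le (hl : 0 < l) (hk : Continuous k) (hC : ∀ t, ‖k t‖ ≤ C) (u : ℝ≥0) :
    ‖averageQuotient a l k u‖
      ≤ averageBound l C * a.variation.real univ * (max 1 (u : ℝ))⁻¹ := by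
  obtain ⟨h1, h2, h3⟩ := averageBound_ge hl ((norm_nonneg _).trans (hC 0))
  by_cases hu : u = 0
  · subst hu
    rw [averageQuotient, if_pos rfl, NNReal.coe_zero, max_eq_left zero_le_one, inv_one, mul_one]
    exact norm_cintegral_le fun r => (norm_smul_expAverage_sub_le hl hC r).trans h1
  · rw [averageQuotient, if_neg hu]
    refine norm_inv_smul_le_inv_max hu ?_ fun hu1 => ?_
    · exact norm_cintegral_le fun r => (norm_expAverage_sub_le hl hC r u).trans h2
    · rw [mul_right_comm]
      refine norm_cintegral_le fun r => (norm_expAverage_add_right_sub_le hl hk hC r hu1).trans ?_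
      exact mul_le_mul_of_nonneg_right h3 u.coe_nonneg

theorem continuous_averageIntegrands (hl : 0 < l) (hk : Continuous k) (hC : ∀ t, ‖k t‖ ≤ C) :
    (Continuous fun r => l • expAverage l k r - k r) ∧
      ∀ u, Continuous fun r => expAverage l k (r + u) - expAverage l k r := by
  have h := continuous_expAverage hl hk hC
  exact ⟨(h.const_smul l).sub hk, fun u => (h.comp (by fun_prop)).sub h⟩

theorem tendsto_averageQuotient (hl : 0 < l) {κ : ℕ → ℝ≥0 → E} (hκ : ∀ n, Continuous (κ n))
    (hC : ∀ n t, ‖κ n t‖ ≤ C) (hlim : ∀ t, Tendsto (fun n => κ n t) atTop (𝓝 (k t))) (u : ℝ≥0) :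
    Tendsto (fun n => averageQuotient a l (κ n) u) atTop (𝓝 (averageQuotient a l k u)) := by
  have h := tendsto_expAverage hl hκ hC hlim
  by_cases hu : u = 0
  · simp only [averageQuotient, if_pos hu]
    exact tendsto_cintegral (fun n => (continuous_averageIntegrands hl (hκ n) (hC n)).1)
      (fun n => norm_smul_expAverage_sub_le hl (hC n))
      fun r => ((h r).const_smul l).sub (hlim r)
  · simp only [averageQuotient, if_neg hu]
    exact (tendsto_cintegral
      (fun n => (continuous_averageIntegrands hl (hκ n) (hC n)).2 u)
      (fun n r => norm_expAverage_sub_le hl (hC n) r u)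
      fun r => (h (r + u)).sub (h r)).const_smul _

theorem averageQuotient_add {k₁ k₂ : ℝ≥0 → E} (hl : 0 < l) (h₁ : Continuous k₁)
    (h₂ : Continuous k₂) {C₁ C₂ : ℝ} (hC₁ : ∀ t, ‖k₁ t‖ ≤ C₁) (hC₂ : ∀ t, ‖k₂ t‖ ≤ C₂) (u : ℝ≥0) :
    averageQuotient a l (k₁ + k₂) u = averageQuotient a l k₁ u + averageQuotient a l k₂ u := by
  have hcont₁ := continuous_averageIntegrands hl h₁ hC₁
  have hcont₂ := continuous_averageIntegrands hl h₂ hC₂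
  simp only [averageQuotient, expAverage_add hl h₁ h₂ hC₁ hC₂]
  split_ifs with hu
  · rw [← cintegral_add (integrable_variation hcont₁.1 (norm_smul_expAverage_sub_le hl hC₁))
      (integrable_variation hcont₂.1 (norm_smul_expAverage_sub_le hl hC₂))]
    congr 1
    funext r
    rw [smul_add, Pi.add_apply]
    abel
  · rw [← smul_add, ← cintegral_add
      (integrable_variation (hcont₁.2 u) fun r => norm_expAverage_sub_le hl hC₁ r u)
      (integrable_variation (hcont₂.2 u) fun r => norm_expAverage_sub_le hl hC₂ r u)]
    congr 2
    funext r
    abel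

theorem averageQuotient_smul (c : ℂ) (u : ℝ≥0) :
    averageQuotient a l (c • k) u = c • averageQuotient a l k u := by
  simp only [averageQuotient, expAverage_smul, Pi.smul_apply, smul_comm _ c, ← smul_sub,
    cintegral_const_smul]
  split_ifs <;> rfl

variable [CompleteSpace E]

theorem averageQuotient_expFun_smul (hl : 0 < l) {s : ℝ} (hs : s ≤ 0) (y : E) (u : ℝ≥0) :
    averageQuotient a l (fun t => expFun s t • y) u
      = levyKernel s u • laplace a s • (l - s)⁻¹ • y := by
  have hls : l - s ≠ 0 := by linarith
  simp only [averageQuotient, levyKernel, expAverage_expFun_smul hl hs]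
  split_ifs with hu
  · have h : (fun r : ℝ≥0 => l • expFun s r • (l - s)⁻¹ • y - expFun s r • y)
        = fun r => expFun s r • s • (l - s)⁻¹ • y := by
      funext r
      rw [smul_comm l, ← smul_sub]
      congr 1
      calc l • (l - s)⁻¹ • y - y = l • (l - s)⁻¹ • y - (l - s) • (l - s)⁻¹ • y := by
            rw [smul_smul (l - s), mul_inv_cancel₀ hls, one_smul]
        _ = s • (l - s)⁻¹ • y := by
            rw [← sub_smul, sub_sub_cancel]
    rw [h, cintegral_smul_const (integrable_expFun hs)]
    exact smul_comm _ _ _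
  · have h : (fun r : ℝ≥0 => expFun s (r + u) • (l - s)⁻¹ • y - expFun s r • (l - s)⁻¹ • y)
        = fun r => expFun s r • (Real.exp (s * u) - 1) • (l - s)⁻¹ • y := by
      funext r
      rw [expFun_add, mul_smul, ← smul_sub, expFun_eq_ofReal s u, Complex.coe_smul, sub_smul,
        one_smul]
    rw [h, cintegral_smul_const (integrable_expFun hs), mul_comm (Real.exp _ - 1),
      mul_smul (u : ℝ)⁻¹]
    congr 1
    exact smul_comm _ _ _

omit [CompleteSpace E] in
theorem expSpan_bounded (hk : k ∈ expSpan E) : ∃ C, ∀ t, ‖k t‖ ≤ C := by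
  induction hk using Submodule.span_induction with
  | mem k hk =>
    obtain ⟨j, y, rfl⟩ := hk
    refine ⟨‖y‖, fun t => ?_⟩
    rw [norm_smul]
    exact mul_le_of_le_one_left (norm_nonneg _) (norm_expFun_le_one (by simp) t)
  | zero => exact ⟨0, fun t => by simp⟩
  | add f g _ _ hf hg =>
    obtain ⟨C₁, h₁⟩ := hf
    obtain ⟨C₂, h₂⟩ := hg
    exact ⟨C₁ + C₂, fun t => (norm_add_le _ _).trans (add_le_add (h₁ t) (h₂ t))⟩
  | smul c f _ hf =>
    obtain ⟨C₁, h₁⟩ := hf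
    refine ⟨‖c‖ * C₁, fun t => ?_⟩
    rw [Pi.smul_apply, norm_smul]
    exact mul_le_mul_of_nonneg_left (h₁ t) (norm_nonneg _)

theorem integral_averageQuotient_of_mem_expSpan (hl : 0 < l) (hψ : ψ 0 = 0)
    (hρ : HasLevyRepr ψ ρ) (hb : ∀ s ≤ 0, (ψ s : ℂ) * laplace a s = laplace b s)
    (hk : k ∈ expSpan E) :
    Integrable (averageQuotient a l k) ρ ∧
      ∫ u, averageQuotient a l k u ∂ρ = cintegral b (expAverage l k) := by
  induction hk using Submodule.span_induction with
  | mem k hk =>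
    obtain ⟨j, y, rfl⟩ := hk
    have hj : -(j : ℝ) ≤ 0 := by simp
    have heq : averageQuotient a l (fun t => expFun (-j) t • y)
        = fun u => levyKernel (-j) u • laplace a (-j) • (l - -(j : ℝ))⁻¹ • y :=
      funext fun u => averageQuotient_expFun_smul hl hj y u
    refine ⟨?_, ?_⟩
    · rw [heq]
      exact (hρ.integrable_levyKernel hj).smul_const _
    · rw [heq, integral_smul_const, expAverage_expFun_smul hl hj,
        cintegral_smul_const (integrable_expFun hj), ← laplace_eq_cintegral_expFun, ← hb _ hj,
        hρ.eq_integral _ hj, hψ, zero_add, mul_smul, Complex.coe_smul]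
  | zero =>
    have h0 : averageQuotient a l (0 : ℝ≥0 → E) = 0 := by
      funext u
      simpa using averageQuotient_smul (a := a) (l := l) (k := (0 : ℝ≥0 → E)) 0 u
    have h1 : expAverage l (0 : ℝ≥0 → E) = 0 := by
      funext t
      simpa using expAverage_smul (l := l) (k := (0 : ℝ≥0 → E)) 0 t
    rw [h0, h1]
    exact ⟨integrable_zero _ _ _, integral_zero _ _ |>.trans cintegral_zero.symm⟩
  | add f g hf' hg' hf hg =>
    obtain ⟨C₁, hC₁⟩ := expSpan_bounded hf'
    obtain ⟨C₂, hC₂⟩ := expSpan_bounded hg'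
    have h₁ := expSpan_continuous hf'
    have h₂ := expSpan_continuous hg'
    have heq : averageQuotient a l (f + g)
        = fun u => averageQuotient a l f u + averageQuotient a l g u :=
      funext (averageQuotient_add hl h₁ h₂ hC₁ hC₂)
    have heq' : expAverage l (f + g) = fun t => expAverage l f t + expAverage l g t :=
      funext (expAverage_add hl h₁ h₂ hC₁ hC₂)
    rw [heq, heq', integral_add hf.1 hg.1, hf.2, hg.2, cintegral_add
      (integrable_variation (continuous_expAverage hl h₁ hC₁) (norm_expAverage_le hl hC₁))
      (integrable_variation (continuous_expAverage hl h₂ hC₂) (norm_expAverage_le hl hC₂))]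
    exact ⟨hf.1.add hg.1, rfl⟩
  | smul c f _ hf =>
    have heq : averageQuotient a l (c • f) = fun u => c • averageQuotient a l f u :=
      funext (averageQuotient_smul c)
    have heq' : expAverage l (c • f) = fun t => c • expAverage l f t := funext (expAverage_smul c)
    rw [heq, heq', integral_smul, hf.2, cintegral_const_smul]
    exact ⟨hf.1.smul c, rfl⟩

/-- The identity `ψ g = Lb`, which is a statement about exponentials, carries over to the
exponential averages of all bounded continuous functions. These averages are `C¹`, which makes the
left-hand side converge, and pointwise bounded convergence of the averaged functions `κₙ → k` forces
convergence of both sides. -/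
theorem integral_averageQuotient (hl : 0 < l) (hψ : ψ 0 = 0) (hρ : HasLevyRepr ψ ρ)
    (hb : ∀ s ≤ 0, (ψ s : ℂ) * laplace a s = laplace b s) (hk : Continuous k)
    (hC : ∀ t, ‖k t‖ ≤ C) :
    ∫ u, averageQuotient a l k u ∂ρ = cintegral b (expAverage l k) := by
  obtain ⟨κ, hκ, hκC, hlim⟩ := exists_seq_expSpan_tendsto hk hC
  have hcont := fun n => expSpan_continuous (hκ n)
  have hexp := fun n => integral_averageQuotient_of_mem_expSpan hl hψ hρ hb (hκ n)
  have hleft : Tendsto (fun n => ∫ u, averageQuotient a l (κ n) u ∂ρ) atTop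
      (𝓝 (∫ u, averageQuotient a l k u ∂ρ)) :=
    tendsto_integral_of_dominated_convergence _ (fun n => (hexp n).1.aestronglyMeasurable)
      (hρ.integrable_inv_max.const_mul (averageBound l (C + 1) * a.variation.real univ))
      (fun n => Eventually.of_forall (norm_averageQuotient_le hl (hcont n) (hκC n)))
      (Eventually.of_forall (tendsto_averageQuotient hl hcont hκC hlim))
  simp_rw [fun n => (hexp n).2] at hleft
  exact tendsto_nhds_unique hleft (tendsto_cintegral
    (fun n => continuous_expAverage hl (hcont n) (hκC n))
    (fun n => norm_expAverage_le hl (hκC n)) (tendsto_expAverage hl hcont hκC hlim))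

end TransferIdentity

/-! ### The semigroup: resolvent, closability and the product formula -/

namespace BoundedC0Semigroup

variable {X : Type*} [NormedAddCommGroup X] [NormedSpace ℂ X] (T : BoundedC0Semigroup X)
  {a b : ComplexMeasure ℝ≥0} {ψ : ℝ → ℝ} {ρ : Measure ℝ≥0} {l M : ℝ}

theorem norm_orbit_le (hM : ∀ t, ‖T.toFun t‖ ≤ M) (x : X) (t : ℝ≥0) :
    ‖T.toFun t x‖ ≤ M * ‖x‖ :=
  (T.toFun t).le_of_opNorm_le (hM t) x

theorem exists_orbit_bound (x : X) : ∃ C, ∀ t, ‖T.toFun t x‖ ≤ C := by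
  obtain ⟨M, hM⟩ := T.bounded
  exact ⟨M * ‖x‖, T.norm_orbit_le hM x⟩

theorem apply_add (s t : ℝ≥0) (x : X) : T.toFun (s + t) x = T.toFun s (T.toFun t x) := by
  rw [T.map_add]
  rfl

theorem apply_comm (s t : ℝ≥0) (x : X) :
    T.toFun s (T.toFun t x) = T.toFun t (T.toFun s x) := by
  rw [← T.apply_add, add_comm, T.apply_add]

theorem generator_eq_of_tendsto {x y : X}
    (h : Tendsto (fun t : ℝ≥0 => (t : ℝ)⁻¹ • (T.toFun t x - x)) (𝓝[>] 0) (𝓝 y)) :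
    ∃ hx : x ∈ T.generator.domain, T.generator ⟨x, hx⟩ = y :=
  ⟨⟨y, h⟩, tendsto_nhds_unique (T.generator_tendsto ⟨x, ⟨y, h⟩⟩) h⟩

/-- The resolvent `R(l, A) x = ∫_{v > 0} e^{-lv} T(v)x dv` of the generator, for `l > 0`. -/
noncomputable def resolvent (hl : 0 < l) : X →L[ℂ] X :=
  LinearMap.mkContinuousOfExistsBound
    { toFun := fun x => expAverage l (fun t => T.toFun t x) 0
      map_add' := fun x y => by
        obtain ⟨C₁, hC₁⟩ := T.exists_orbit_bound x
        obtain ⟨C₂, hC₂⟩ := T.exists_orbit_bound y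
        rw [← expAverage_add hl (T.continuous_orbit x) (T.continuous_orbit y) hC₁ hC₂]
        simp only [_root_.map_add]
        rfl
      map_smul' := fun c x => by
        rw [RingHom.id_apply, ← expAverage_smul]
        simp only [map_smul]
        rfl }
    (by
      obtain ⟨M, hM⟩ := T.bounded
      refine ⟨M * l⁻¹, fun x => (norm_expAverage_le hl (T.norm_orbit_le hM x) 0).trans_eq ?_⟩
      ring)

theorem resolvent_apply (hl : 0 < l) (x : X) :
    T.resolvent hl x = expAverage l (fun t => T.toFun t x) 0 := rfl

theorem hillePhillips_apply (x : X) : T.hillePhillips a x = cintegral a fun u => T.toFun u x := rfl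

variable [CompleteSpace X]

theorem apply_resolvent (hl : 0 < l) (t : ℝ≥0) (x : X) :
    T.toFun t (T.resolvent hl x) = expAverage l (fun r => T.toFun r x) t := by
  obtain ⟨C, hC⟩ := T.exists_orbit_bound x
  rw [resolvent_apply, ← expAverage_comp_comm hl (T.continuous_orbit x) hC]
  simp only [expAverage, zero_add, T.apply_add]

theorem resolvent_apply_comm (hl : 0 < l) (t : ℝ≥0) (x : X) :
    T.resolvent hl (T.toFun t x) = T.toFun t (T.resolvent hl x) := by
  obtain ⟨C, hC⟩ := T.exists_orbit_bound x
  rw [resolvent_apply, resolvent_apply, ← expAverage_comp_comm hl (T.continuous_orbit x) hC]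
  simp only [T.apply_comm t]

theorem generator_resolvent (hl : 0 < l) (x : X) :
    ∃ hx : T.resolvent hl x ∈ T.generator.domain,
      T.generator ⟨T.resolvent hl x, hx⟩ = l • T.resolvent hl x - x := by
  obtain ⟨C, hC⟩ := T.exists_orbit_bound x
  refine T.generator_eq_of_tendsto ?_
  have h := tendsto_inv_smul_expAverage_sub hl (T.continuous_orbit x) hC 0
  simp only [zero_add, ← T.apply_resolvent hl, T.map_zero, ContinuousLinearMap.id_apply] at h
  exact h

/-- The range of the resolvent, and so `D(A)`, is dense: `n R(n, A) x → x`. -/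
theorem tendsto_smul_resolvent (x : X) :
    Tendsto (fun n : ℕ => ((n : ℝ) + 1) • T.resolvent (l := (n : ℝ) + 1) (by positivity) x) atTop
      (𝓝 x) := by
  obtain ⟨C, hC⟩ := T.exists_orbit_bound x
  have hscale : ∀ n : ℕ, ((n : ℝ) + 1) • T.resolvent (l := (n : ℝ) + 1) (by positivity) x
      = ∫ w in Ioi (0 : ℝ), Real.exp (-1 * w) • T.toFun (w * (1 / ((n : ℝ) + 1))).toNNReal x := by
    intro n
    have hn : (0 : ℝ) < (n : ℝ) + 1 := by positivity
    have h := integral_comp_mul_left_Ioi (fun w => Real.exp (-1 * w) •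
      T.toFun (w * (1 / ((n : ℝ) + 1))).toNNReal x) 0 hn
    rw [mul_zero, eq_inv_smul_iff₀ hn.ne'] at h
    rw [resolvent_apply, expAverage, ← h]
    congr 2
    funext v
    rw [zero_add]
    congr 2
    · ring
    · congr 1
      field_simp
  simp_rw [hscale]
  have hlim : Tendsto
      (fun n : ℕ => ∫ w in Ioi (0 : ℝ),
        Real.exp (-1 * w) • T.toFun (w * (1 / ((n : ℝ) + 1))).toNNReal x)
      atTop (𝓝 (∫ w in Ioi (0 : ℝ), Real.exp (-1 * w) • x)) := by
    refine tendsto_integral_of_dominated_convergence (fun w => C * Real.exp (-1 * w)) (fun n => ?_)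
      ((exp_neg_integrableOn_Ioi 0 one_pos).const_mul C) (fun n => ?_) ?_
    · have := T.continuous_orbit x
      exact Continuous.aestronglyMeasurable (by fun_prop)
    · refine Eventually.of_forall fun w => ?_
      rw [norm_smul, Real.norm_of_nonneg (Real.exp_pos _).le, mul_comm]
      exact mul_le_mul_of_nonneg_right (hC _) (Real.exp_pos _).le
    · refine Eventually.of_forall fun w => Tendsto.const_smul ?_ _
      have h1 : Tendsto (fun n : ℕ => (w * (1 / ((n : ℝ) + 1))).toNNReal) atTop (𝓝 0) := by
        have h2 := (tendsto_one_div_add_atTop_nhds_zero_nat (𝕜 := ℝ)).const_mul w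
        rw [mul_zero] at h2
        have h3 := (continuous_real_toNNReal.tendsto 0).comp h2
        rwa [Real.toNNReal_zero] at h3
      have h3 := ((T.continuous_orbit x).tendsto 0).comp h1
      rwa [T.map_zero] at h3
  rwa [integral_smul_const, integral_exp_neg_mul_Ioi_zero one_pos, inv_one, one_smul] at hlim

theorem apply_hillePhillips (t : ℝ≥0) (x : X) :
    T.toFun t (T.hillePhillips a x) = T.hillePhillips a (T.toFun t x) := by
  rw [hillePhillips_apply, ← cintegral_comp_comm (T.toFun t) (T.integrable_orbit a x)]
  simp only [T.apply_comm t]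
  rfl

theorem generator_hillePhillips (z : T.generator.domain) :
    ∃ hx : T.hillePhillips a z ∈ T.generator.domain,
      T.generator ⟨T.hillePhillips a z, hx⟩ = T.hillePhillips a (T.generator z) := by
  refine T.generator_eq_of_tendsto ?_
  refine (((T.hillePhillips a).continuous.tendsto _).comp (T.generator_tendsto z)).congr fun u => ?_
  rw [Function.comp_apply, ContinuousLinearMap.map_smul_of_tower, map_sub, T.apply_hillePhillips]

theorem hillePhillips_resolvent_mem (hl : 0 < l) (x : X) :
    T.hillePhillips a (T.resolvent hl x) ∈ T.generator.domain :=
  (T.generator_hillePhillips ⟨_, (T.generator_resolvent hl x).choose⟩).choose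

theorem orbitQuotient_hillePhillips_resolvent (hl : 0 < l) (x : X) (u : ℝ≥0) :
    T.orbitQuotient ⟨T.hillePhillips a (T.resolvent hl x), T.hillePhillips_resolvent_mem hl x⟩ u
      = averageQuotient a l (fun r => T.toFun r x) u := by
  obtain ⟨hx, hAx⟩ := T.generator_resolvent hl x
  obtain ⟨_, hgx⟩ := T.generator_hillePhillips (a := a) ⟨_, hx⟩
  simp only [orbitQuotient, averageQuotient, ← T.apply_resolvent hl]
  split_ifs with hu
  · rw [hgx, hAx, hillePhillips_apply]
    simp only [map_sub, ContinuousLinearMap.map_smul_of_tower]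
  · rw [T.apply_hillePhillips, hillePhillips_apply, hillePhillips_apply, ← cintegral_sub
      (T.integrable_orbit a _) (T.integrable_orbit a _)]
    simp only [T.apply_add]

/-- The identity `ψ(A) g(A) = h(A)` on the range of the resolvent, that is, on `D(A)`, where `ψ(A)`
needs no closure. -/
theorem bochnerPhillipsCore_hillePhillips_resolvent (hψ : ψ 0 = 0) (hρ : HasLevyRepr ψ ρ)
    (hb : ∀ s ≤ 0, (ψ s : ℂ) * laplace a s = laplace b s) (hl : 0 < l) (x : X) :
    (T.hillePhillips a (T.resolvent hl x), T.hillePhillips b (T.resolvent hl x))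
      ∈ (T.bochnerPhillipsCore hρ).graph := by
  obtain ⟨C, hC⟩ := T.exists_orbit_bound x
  refine (LinearPMap.mem_graph_iff _).2
    ⟨⟨_, T.hillePhillips_resolvent_mem (a := a) hl x⟩, rfl, ?_⟩
  change (ψ 0 : ℂ) • _ + ∫ u, T.orbitQuotient
    ⟨_, T.hillePhillips_resolvent_mem (a := a) hl x⟩ u ∂ρ = _
  simp_rw [T.orbitQuotient_hillePhillips_resolvent hl x]
  rw [hψ, Complex.ofReal_zero, zero_smul, zero_add,
    integral_averageQuotient hl hψ hρ hb (T.continuous_orbit x) hC, hillePhillips_apply]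
  simp only [T.apply_resolvent hl]

theorem norm_resolvent_orbitQuotient_le (hM : ∀ t, ‖T.toFun t‖ ≤ M) (hl : 0 < l)
    (x : T.generator.domain) (u : ℝ≥0) :
    ‖T.resolvent hl (T.orbitQuotient x u)‖
      ≤ averageBound l (M * ‖(x : X)‖) * (max 1 (u : ℝ))⁻¹ := by
  have hC := T.norm_orbit_le hM (x : X)
  obtain ⟨h1, h2, h3⟩ := averageBound_ge hl ((norm_nonneg _).trans (hC 0))
  have key : ∀ u : ℝ≥0, u ≠ 0 → ‖T.resolvent hl ((u : ℝ)⁻¹ • (T.toFun u x - x))‖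
      ≤ averageBound l (M * ‖(x : X)‖) * (max 1 (u : ℝ))⁻¹ := fun u hu => by
    have heq : T.resolvent hl ((u : ℝ)⁻¹ • (T.toFun u x - x)) = (u : ℝ)⁻¹ •
        (expAverage l (fun r => T.toFun r x) (0 + u) - expAverage l (fun r => T.toFun r x) 0) := by
      rw [ContinuousLinearMap.map_smul_of_tower, map_sub, T.resolvent_apply_comm,
        T.apply_resolvent, zero_add,
        resolvent_apply]
    rw [heq]
    refine norm_inv_smul_le_inv_max hu ((norm_expAverage_sub_le hl hC 0 u).trans h2) fun hu1 => ?_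
    exact (norm_expAverage_add_right_sub_le hl (T.continuous_orbit x) hC 0 hu1).trans
      (mul_le_mul_of_nonneg_right h3 u.coe_nonneg)
  by_cases hu : u = 0
  · subst hu
    rw [orbitQuotient, if_pos rfl, NNReal.coe_zero, max_eq_left zero_le_one, inv_one, mul_one]
    refine le_of_tendsto
      (((T.resolvent hl).continuous.tendsto _).comp (T.generator_tendsto x)).norm ?_
    filter_upwards [self_mem_nhdsWithin] with v hv
    refine (key v (ne_of_gt hv)).trans (mul_le_of_le_one_right ?_ ?_)
    · exact le_trans (mul_nonneg zero_le_two ((norm_nonneg _).trans (hC 0))) h1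
    · exact inv_le_one_of_one_le₀ (le_max_left _ _)
  · rw [orbitQuotient, if_neg hu]
    exact key u hu

/-- Composing the core of `ψ(A)` with a resolvent gives an operator that is bounded for the norm of
`X`. -/
theorem norm_resolvent_bochnerPhillipsCore_le (hψ : ψ 0 = 0) (hρ : HasLevyRepr ψ ρ)
    (hM : ∀ t, ‖T.toFun t‖ ≤ M) (hl : 0 < l) (x : T.generator.domain) :
    ‖T.resolvent hl (T.bochnerPhillipsCore hρ x)‖
      ≤ (averageBound l M * ∫ u : ℝ≥0, (max 1 (u : ℝ))⁻¹ ∂ρ) * ‖(x : X)‖ := by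
  have hcore : T.bochnerPhillipsCore hρ x = ∫ u, T.orbitQuotient x u ∂ρ := by
    change (ψ 0 : ℂ) • (x : X) + ∫ u, T.orbitQuotient x u ∂ρ = _
    rw [hψ, Complex.ofReal_zero, zero_smul, zero_add]
  rw [hcore, ← (T.resolvent hl).integral_comp_comm (T.integrable_orbitQuotient hρ x)]
  refine (norm_integral_le_of_norm_le (hρ.integrable_inv_max.const_mul _)
    (Eventually.of_forall (T.norm_resolvent_orbitQuotient_le hM hl x))).trans_eq ?_
  rw [integral_const_mul, averageBound, averageBound]
  ring

theorem isClosable_bochnerPhillipsCore (hψ : ψ 0 = 0) (hρ : HasLevyRepr ψ ρ) :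
    (T.bochnerPhillipsCore hρ).IsClosable := by
  obtain ⟨M, hM⟩ := T.bounded
  refine ⟨(T.bochnerPhillipsCore hρ).graph.topologicalClosure.toLinearPMap,
    (Submodule.toLinearPMap_graph_eq _ ?_).symm⟩
  rintro ⟨x, z⟩ hp (rfl : x = 0)
  -- A point `(0, z)` of the closure of the graph satisfies `R(l, A) z = 0` for all `l > 0`.
  have hR : ∀ {l : ℝ} (hl : 0 < l), T.resolvent hl z = 0 := fun {l} hl => by
    set D := averageBound l M * ∫ u : ℝ≥0, (max 1 (u : ℝ))⁻¹ ∂ρ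
    have hclosed : IsClosed {p : X × X | ‖T.resolvent hl p.2‖ ≤ D * ‖p.1‖} :=
      isClosed_le (by fun_prop) (by fun_prop)
    have hsub : ((T.bochnerPhillipsCore hρ).graph : Set (X × X))
        ⊆ {p : X × X | ‖T.resolvent hl p.2‖ ≤ D * ‖p.1‖} := by
      rintro ⟨y, w⟩ hyw
      obtain ⟨y, rfl, rfl⟩ := (LinearPMap.mem_graph_iff _).1 hyw
      exact T.norm_resolvent_bochnerPhillipsCore_le hψ hρ hM hl y
    have h := hclosed.closure_subset_iff.2 hsub hp
    simpa using h
  have h := T.tendsto_smul_resolvent z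
  simp only [hR, smul_zero] at h
  exact (tendsto_nhds_unique tendsto_const_nhds h).symm

theorem mem_graph_bochnerPhillips (hψ : ψ 0 = 0) (hρ : HasLevyRepr ψ ρ)
    (hb : ∀ s ≤ 0, (ψ s : ℂ) * laplace a s = laplace b s) (x : X) :
    (T.hillePhillips a x, T.hillePhillips b x) ∈ (T.bochnerPhillips hρ).graph := by
  rw [bochnerPhillips,
    ← (T.isClosable_bochnerPhillipsCore hψ hρ).graph_closure_eq_closure_graph]
  have hlim := T.tendsto_smul_resolvent x
  refine mem_closure_of_tendsto ((((T.hillePhillips a).continuous.tendsto x).comp hlim).prodMk_nhds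
    (((T.hillePhillips b).continuous.tendsto x).comp hlim)) (Eventually.of_forall fun n => ?_)
  simp only [Function.comp_apply, ContinuousLinearMap.map_smul_of_tower]
  have h := (T.bochnerPhillipsCore hρ).graph.smul_mem (((n : ℝ) + 1 : ℝ) : ℂ)
    (T.bochnerPhillipsCore_hillePhillips_resolvent hψ hρ hb
      (l := (n : ℝ) + 1) (by positivity) x)
  rwa [Prod.smul_mk, Complex.coe_smul, Complex.coe_smul] at h

omit [CompleteSpace X] in
theorem norm_hillePhillips_le (hM : ∀ t, ‖T.toFun t‖ ≤ M) :
    ‖T.hillePhillips b‖ ≤ M * b.variation.real univ := by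
  have hM0 : 0 ≤ M := (norm_nonneg _).trans (hM 0)
  refine ContinuousLinearMap.opNorm_le_bound _ (by positivity) fun x => ?_
  rw [hillePhillips_apply, mul_right_comm]
  exact norm_cintegral_le (T.norm_orbit_le hM x)

end BoundedC0Semigroup

end Subordination

theorem theorem1 (a : ComplexMeasure ℝ≥0) (ψ : ℝ → ℝ) (ρ : Measure ℝ≥0)
    (hψ : Subordination.IsNegBernsteinZero ψ) (hρ : Subordination.HasLevyRepr ψ ρ)
    (hK : Subordination.K a ρ < ∞) :
    (∃ b : ComplexMeasure ℝ≥0,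
      (∀ s : ℝ, s ≤ 0 →
        (ψ s : ℂ) * Subordination.laplace a s = Subordination.laplace b s) ∧
      b.variation univ = Subordination.K a ρ) ∧
    ∀ b : ComplexMeasure ℝ≥0,
      (∀ s : ℝ, s ≤ 0 →
        (ψ s : ℂ) * Subordination.laplace a s = Subordination.laplace b s) →
      ∀ (X : Type*) [NormedAddCommGroup X] [NormedSpace ℂ X] [CompleteSpace X]
        (T : Subordination.BoundedC0Semigroup X) (M : ℝ), (∀ t : ℝ≥0, ‖T.toFun t‖ ≤ M) →
        (∀ x : X, T.hillePhillips a x ∈ (T.bochnerPhillips hρ).domain) ∧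
        (∀ (x : X) (hx : T.hillePhillips a x ∈ (T.bochnerPhillips hρ).domain),
          T.hillePhillips b x = T.bochnerPhillips hρ ⟨T.hillePhillips a x, hx⟩) ∧
        ‖T.hillePhillips b‖ ≤ M * (Subordination.K a ρ).toReal := by
  obtain ⟨b₀, hb₀, hle⟩ := Subordination.exists_laplace_eq_mul_laplace hψ hρ hK
  have hvar : b₀.variation univ = Subordination.K a ρ :=
    hle.antisymm (Subordination.K_le_variation hψ.map_zero hρ hb₀)
  refine ⟨⟨b₀, hb₀, hvar⟩, fun b hb X _ _ _ T M hM => ?_⟩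
  have hgraph := T.mem_graph_bochnerPhillips hψ.map_zero hρ hb
  refine ⟨fun x => LinearPMap.mem_domain_of_mem_graph (hgraph x), fun x hx => ?_, ?_⟩
  · exact LinearPMap.mem_graph_snd_inj _ (hgraph x)
      (LinearPMap.mem_graph _ ⟨T.hillePhillips a x, hx⟩) rfl
  · have hbb₀ : b = b₀ :=
      Subordination.eq_of_laplace_eq fun s hs => (hb s hs).symm.trans (hb₀ s hs)
    rw [← hvar, hbb₀]
    exact T.norm_hillePhillips_le hM
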